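/- Throughout, $B(x,r)$ denotes the open ball of centre $x$ and radius $r$. Let $\mu$ be a locally finite Borel measure on a metric space with support $\operatorname{supp}(\mu)$. - The upper regularity dimension $\overline{\dim}_{\mathrm{reg}}\,\mu$ is the infimum of all $s\ge 0$ for which there is a constant $C>0$ such that $\mu(B(x,R))/\mu(B(x,r))\le C(R/r)^s$ for all $0<r<R$ and all $x\in\operatorname{supp}(\mu)$, with the convention $\inf\emptyset=+\infty$. - $\mu$ is doubling if there is a constant $0<C<\infty$ such that $\mu(B(x,R))/\mu(B(x,R/2))\le C$ for all $R>0$ and $x\in\operatorname{supp}(\mu)$. - The upper local dimension of $\mu$ at $x\in\operatorname{supp}(\mu)$ is $\overline{\dim}_{\mathrm{loc}}(x,\mu)=\limsup_{r\to0^+}\log\mu(B(x,r))/\log r$. - The Assouad dimension $\dim_{\mathrm A}F$ of a set $F$ is the infimum of all $s\ge 0$ for which there is $C>0$ such that, for all $0<r<R$ and $x\in F$, the set $F\cap B(x,R)$ can be covered by at most $C(R/r)^s$ balls of radius $r$ (again with $\inf\emptyset=+\infty$). For a sequence of points $x_n\searrow 0$ and weights $p(n)\searrow 0$ with $p(n)>0$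 and $\sum_{n\ge1}p(n)<\infty$, consider the probability measure on $\mathbb R$ $$\mu=\frac{1}{\sum_{n=1}^\infty p(n)}\sum_{n=1}^\infty p(n)\,\delta_{x_n}.$$ **Theorem 2.6.** 1. (Polynomial–polynomial) Let $\lambda>0$ and $\omega>1$, and let $x_n=n^{-\lambda}$, $p(n)=n^{-\omega}$. Then $$\overline{\dim}_{\mathrm{reg}}\,\mu=\max\Big\{1,\frac{\omega-1}{\lambda}\Big\}=\max\Big\{\dim_{\mathrm A}\operatorname{supp}(\mu),\ \sup_{x\in\operatorname{supp}(\mu)}\overline{\dim}_{\mathrm{loc}}(x,\mu)\Big\}.$$ 2. (Exponential–exponential) Let $\lambda,\omega\in(0,1)$, and let $x_n=\lambda^n$, $p(n)=\omega^n$. Then $$\overline{\dim}_{\mathrm{reg}}\,\mu=\frac{\log\omega}{\log\lambda}=\sup_{x\in\operatorname{supp}(\mu)}\overline{\dim}_{\mathrm{loc}}(x,\mu)>0=\dim_{\mathrm A}\operatorname{supp}(\mu).$$ 3. (Mixed rates) If either (i) $x_n=n^{-\lambda}$ and $p(n)=\omega^n$ with $\lambda>0$ and $0<\omega<1$, or (ii)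 $x_n=\lambda^n$ and $p(n)=n^{-\omega}$ with $0<\lambda<1$ and $\omega>1$, then $\mu$ is not doubling, and $\overline{\dim}_{\mathrm{reg}}\,\mu=\infty$. -/

import Mathlib

open MeasureTheory Filter Topology
open scoped ENNReal NNReal

noncomputable section

/-- The upper regularity dimension of a measure: the infimum (in the extended reals, so that
`inf ∅ = +∞`) of all `s ≥ 0` for which there is `C > 0` such that
`μ (B(x,R)) / μ (B(x,r)) ≤ C (R/r)^s` for all `0 < r < R` and all `x ∈ supp μ`, with open balls.
The denominator is positive on the support, so the quotient bound is written as a product. -/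
def upperRegularityDim {X : Type*} [PseudoMetricSpace X] [MeasurableSpace X]
    (μ : Measure X) : EReal :=
  sInf ((fun s : ℝ => (s : EReal)) '' {s : ℝ | 0 ≤ s ∧ ∃ C : ℝ, 0 < C ∧
    ∀ r R : ℝ, 0 < r → r < R → ∀ x ∈ μ.support,
      μ (Metric.ball x R) ≤ ENNReal.ofReal (C * (R / r) ^ s) * μ (Metric.ball x r)})

/-- A measure is doubling if `μ (B(x,R)) / μ (B(x,R/2)) ≤ C` for some finite `C > 0`, all `R > 0`
and all `x ∈ supp μ`. -/
def IsDoublingMeas {X : Type*} [PseudoMetricSpace X] [MeasurableSpace X]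
    (μ : Measure X) : Prop :=
  ∃ C : ℝ, 0 < C ∧ ∀ R : ℝ, 0 < R → ∀ x ∈ μ.support,
    μ (Metric.ball x R) ≤ ENNReal.ofReal C * μ (Metric.ball x (R / 2))

/-- The upper local dimension of a locally finite measure at a point `x` of its support:
`limsup_{r → 0+} log μ(B(x,r)) / log r`. -/
def upperLocalDim {X : Type*} [PseudoMetricSpace X] [MeasurableSpace X]
    (μ : Measure X) (x : X) : EReal :=
  limsup (fun r : ℝ =>
    ((Real.log (μ.real (Metric.ball x r)) / Real.log r : ℝ) : EReal)) (𝓝[>] (0 : ℝ))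

/-- The Assouad dimension of a set `F`: the infimum of all `s ≥ 0` for which there is `C > 0` such
that, for all `0 < r < R` and `x ∈ F`, the set `F ∩ B(x,R)` can be covered by at most `C (R/r)^s`
balls of radius `r`. -/
def assouadDim {X : Type*} [PseudoMetricSpace X] (F : Set X) : EReal :=
  sInf ((fun s : ℝ => (s : EReal)) '' {s : ℝ | 0 ≤ s ∧ ∃ C : ℝ, 0 < C ∧
    ∀ (r : ℝ≥0) (R : ℝ), 0 < r → (r : ℝ) < R → ∀ x ∈ F,
      ((Metric.externalCoveringNumber r (F ∩ Metric.ball x R) : ℕ∞) : ℝ≥0∞)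
        ≤ ENNReal.ofReal (C * (R / r) ^ s)})

/-- The normalised measure `(∑_{n ≥ 1} p n)⁻¹ ∑_{n ≥ 1} p n δ_{x n}` on the line, for nonnegative
weights `p`. The sums start at `n = 1`, hence the shift. -/
def sequenceMeasure (x p : ℕ → ℝ) : Measure ℝ :=
  (∑' n : ℕ, ENNReal.ofReal (p (n + 1)))⁻¹ •
    Measure.sum (fun n : ℕ => ENNReal.ofReal (p (n + 1)) • Measure.dirac (x (n + 1)))

end

/-! The normalising factor cancels from mass ratios and does not affect local dimensions, so
everything reduces to the real-valued weights `pointMass` of balls.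

When the two rates match, the mass of B(0,r) is comparable to r^t for small r, with t = (ω-1)/λ or t
= log ω / log λ (`massComparable_power`, `massComparable_geometric`). Hence the local dimension at 0
is t, while every x_n is an atom of local dimension 0; letting r → 0 with R = 1 at the origin also
gives t as a lower bound for the regularity dimension.

For the upper bound, a ball about x_n of radius at least of order x_n behaves like a ball about 0,
so only smaller radii matter (`upperRegularityDim_le_of_massComparable`). In the geometric case a
sufficiently small multiple of x_n isolates the atom. In the power case the points near x_n have
spacing of order n^(-λ-1) and nearly equal weights, so for radii below a fixed multiple of x_n the
mass is of order (1 + r n^(λ+1)) n^(-ω). This grows at most linearly in r, and it does so over a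
range of scales of ratio n, which forces the value 1 in the maximum. The same spacing gives Assouad
dimension 1, whereas a geometric sequence needs only O(1 + log(R/r)) balls, giving 0.

For mixed rates a dilation by a fixed factor can multiply the mass by an arbitrarily large amount,
which rules out both doubling and every exponent s. -/

/-- The tangent line inequality for the convex function `a ↦ a ^ (-l)` on the positive reals. -/
lemma rpow_neg_tangent_le {l a b : ℝ} (hl : 0 < l) (ha : 0 < a) (hb : 0 < b) :
    b ^ (-l) - l * b ^ (-l - 1) * (a - b) ≤ a ^ (-l) := by
  -- Combine exp u ≥ 1 + u at u = -l log(a/b) with log v ≤ v - 1 at v = a/b.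
  have h1 : 1 - l * (a / b - 1) ≤ (a / b) ^ (-l) := by
    have h2 := Real.log_le_sub_one_of_pos (div_pos ha hb)
    have h3 := Real.add_one_le_exp (Real.log (a / b) * -l)
    rw [Real.rpow_def_of_pos (div_pos ha hb)]
    nlinarith
  have h4 : a ^ (-l) = b ^ (-l) * (a / b) ^ (-l) := by
    rw [← Real.mul_rpow hb.le (div_pos ha hb).le]; congr 1; field_simp
  have h5 : b ^ (-l - 1) = b ^ (-l) / b := by rw [Real.rpow_sub_one hb.ne']
  have h6 : b ^ (-l) - l * b ^ (-l - 1) * (a - b) = b ^ (-l) * (1 - l * (a / b - 1)) := by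
    rw [h5]; field_simp
  rw [h4, h6]
  exact mul_le_mul_of_nonneg_left h1 (Real.rpow_nonneg hb.le _)

/-- A power of a null sequence that stays bounded away from zero has nonpositive exponent. -/
lemma exponent_nonpos_of_le_mul_rpow {ι : Type*} {l : Filter ι} [l.NeBot] {u : ι → ℝ}
    (hu : Tendsto u l (𝓝 0)) {a c K : ℝ} (hc : 0 < c) (h : ∀ᶠ i in l, c ≤ K * u i ^ a) :
    a ≤ 0 := by
  by_contra! ha
  have h1 : Tendsto (fun i => K * u i ^ a) l (𝓝 (K * 0 ^ a)) :=
    ((Real.continuousAt_rpow_const 0 a (Or.inr ha.le)).tendsto.comp hu).const_mul K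
  rw [Real.zero_rpow ha.ne', mul_zero] at h1
  exact absurd (ge_of_tendsto h1 h) (not_le.2 hc)

/-- The number of natural numbers in a real interval exceeds its length by at most one. -/
lemma exists_finset_nat_mem_Icc {a b : ℝ} (hab : a ≤ b) :
    ∃ s : Finset ℕ, (∀ m : ℕ, a ≤ m → (m : ℝ) ≤ b → m ∈ s) ∧ (s.card : ℝ) ≤ b - a + 1 := by
  rcases lt_or_ge b 0 with hb | hb
  · refine ⟨∅, fun m _ hm => ?_, by simp; linarith⟩
    have : (0 : ℝ) ≤ m := m.cast_nonneg
    linarith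
  refine ⟨Finset.Icc ⌈a⌉₊ ⌊b⌋₊, fun m h1 h2 => by
    rw [Finset.mem_Icc, Nat.ceil_le, Nat.le_floor_iff hb]; exact ⟨h1, h2⟩, ?_⟩
  rw [Nat.card_Icc]
  rcases le_total (⌊b⌋₊ + 1) ⌈a⌉₊ with h | h
  · rw [Nat.sub_eq_zero_of_le h]; push_cast; linarith
  · rw [Nat.cast_sub h]
    have := Nat.floor_le hb
    have := Nat.le_ceil a
    push_cast; linarith

/-! ### Weights of sets and the passage from measures to real inequalities. -/

section PointMass

/-- The total weight `p n` of the points `x n`, `n ≥ 1`, that lie in `A`. -/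
noncomputable def pointMass (x p : ℕ → ℝ) (A : Set ℝ) : ℝ :=
  ∑' n : ℕ, ((fun n => x (n + 1)) ⁻¹' A).indicator (fun n => p (n + 1)) n

lemma pointMass_le_card_mul {A : Set ℝ} {s : Finset ℕ} {q : ℝ} (hq0 : 0 ≤ q)
    (hs : ∀ n, 1 ≤ n → x n ∈ A → n ∈ s ∧ p n ≤ q) :
    pointMass x p A ≤ s.card * q := by
  have h1 : pointMass x p A = ∑ k ∈ s.image (fun n => n - 1),
      ((fun n => x (n + 1)) ⁻¹' A).indicator (fun n => p (n + 1)) k := by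
    refine tsum_eq_sum fun k hk => Set.indicator_of_notMem (fun hkA => hk ?_) _
    exact Finset.mem_image.2 ⟨k + 1, (hs (k + 1) (by omega) hkA).1, rfl⟩
  rw [h1]
  calc _ ≤ ((s.image (fun n => n - 1)).card : ℝ) * q := by
        rw [← nsmul_eq_mul]
        refine Finset.sum_le_card_nsmul _ _ _ fun k _ => ?_
        by_cases hk : x (k + 1) ∈ A
        · rw [Set.indicator_of_mem (by simpa using hk)]
          exact (hs _ (by omega) hk).2
        · rw [Set.indicator_of_notMem (by simpa using hk)]
          exact hq0
    _ ≤ _ := mul_le_mul_of_nonneg_right (Nat.cast_le.2 Finset.card_image_le) hq0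

/-- Positive points decreasing to zero, carrying positive summable weights. -/
structure IsMassSequence (x p : ℕ → ℝ) : Prop where
  point_pos : ∀ n, 1 ≤ n → 0 < x n
  point_anti : ∀ m n, 1 ≤ m → m ≤ n → x n ≤ x m
  point_tendsto : Tendsto x atTop (𝓝 0)
  weight_pos : ∀ n, 1 ≤ n → 0 < p n
  weight_summable : Summable p

namespace IsMassSequence

variable {x p : ℕ → ℝ} (h : IsMassSequence x p)
include h

lemma summable_shift : Summable (fun n => p (n + 1)) :=
  (summable_nat_add_iff 1).2 h.weight_summable

lemma weight_shift_nonneg (n : ℕ) : 0 ≤ p (n + 1) := (h.weight_pos _ (by omega)).le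

lemma summable_indicator (A : Set ℝ) :
    Summable (((fun n => x (n + 1)) ⁻¹' A).indicator (fun n => p (n + 1))) :=
  h.summable_shift.indicator _

lemma indicator_nonneg (A : Set ℝ) (n : ℕ) :
    0 ≤ ((fun n => x (n + 1)) ⁻¹' A).indicator (fun n => p (n + 1)) n :=
  Set.indicator_nonneg (fun n _ => h.weight_shift_nonneg n) n

lemma pointMass_nonneg (A : Set ℝ) : 0 ≤ pointMass x p A :=
  tsum_nonneg (h.indicator_nonneg A)

lemma pointMass_mono {A B : Set ℝ} (hAB : A ⊆ B) : pointMass x p A ≤ pointMass x p B :=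
  (h.summable_indicator A).tsum_le_tsum
    (fun n => Set.indicator_le_indicator_of_subset (Set.preimage_mono hAB)
      h.weight_shift_nonneg n) (h.summable_indicator B)

lemma sum_le_pointMass {A : Set ℝ} {s : Finset ℕ} (hs : ∀ n ∈ s, 1 ≤ n ∧ x n ∈ A) :
    ∑ n ∈ s, p n ≤ pointMass x p A := by
  -- `pointMass` is summed over k = n - 1; truncated subtraction is injective on `s` because its
  -- indices are at least 1.
  have h1 : ∑ n ∈ s, p n = ∑ k ∈ s.image (fun n => n - 1),
      ((fun n => x (n + 1)) ⁻¹' A).indicator (fun n => p (n + 1)) k := by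
    rw [Finset.sum_image]
    · refine Finset.sum_congr rfl fun n hn => ?_
      obtain ⟨h1, h2⟩ := hs n hn
      obtain ⟨k, rfl⟩ := Nat.exists_eq_add_of_le' h1
      rw [Set.indicator_of_mem] <;> simp [h2]
    · intro a ha b hb hab
      have := (hs a ha).1
      have := (hs b hb).1
      simp only at hab
      omega
  rw [h1]
  exact (h.summable_indicator A).sum_le_tsum _ (fun n _ => h.indicator_nonneg A n)

lemma weight_le_pointMass {A : Set ℝ} {n : ℕ} (hn : 1 ≤ n) (hA : x n ∈ A) :
    p n ≤ pointMass x p A := by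
  simpa using h.sum_le_pointMass (A := A) (s := {n}) (by simpa using ⟨hn, hA⟩)

lemma card_mul_le_pointMass {A : Set ℝ} {s : Finset ℕ} {q : ℝ}
    (hs : ∀ n ∈ s, 1 ≤ n ∧ x n ∈ A) (hq : ∀ n ∈ s, q ≤ p n) :
    s.card * q ≤ pointMass x p A := by
  refine le_trans ?_ (h.sum_le_pointMass hs)
  simpa [nsmul_eq_mul] using Finset.card_nsmul_le_sum s p q hq

lemma tail_le_pointMass {A : Set ℝ} {N : ℕ} (hN : 1 ≤ N) (hA : ∀ n, N ≤ n → x n ∈ A) :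
    ∑' k, p (N + k) ≤ pointMass x p A := by
  have hs : Summable (fun k => p (N + k)) := by
    simpa only [add_comm N] using (summable_nat_add_iff N).2 h.weight_summable
  refine hs.tsum_le_of_sum_range_le fun m => ?_
  have h1 := h.sum_le_pointMass (A := A) (s := (Finset.range m).map (addLeftEmbedding N))
    fun n hn => by
      obtain ⟨k, -, rfl⟩ := Finset.mem_map.1 hn
      exact ⟨hN.trans (Nat.le_add_right N k), hA _ (Nat.le_add_right N k)⟩
  simpa using h1

lemma pointMass_le_tail {A : Set ℝ} {N : ℕ} (hN : 1 ≤ N)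
    (hA : ∀ n, 1 ≤ n → x n ∈ A → N ≤ n) :
    pointMass x p A ≤ ∑' k, p (N + k) := by
  obtain ⟨N, rfl⟩ := Nat.exists_eq_add_of_le' hN
  rw [pointMass, ← (h.summable_indicator A).sum_add_tsum_nat_add N, Finset.sum_eq_zero, zero_add]
  · refine ((summable_nat_add_iff N).2 (h.summable_indicator A)).tsum_le_tsum (fun k => ?_) ?_
    · rw [show N + 1 + k = k + N + 1 by ring]
      exact Set.indicator_le_self' (fun _ _ => h.weight_shift_nonneg _) _
    · simpa only [add_comm (N + 1)] using (summable_nat_add_iff (N + 1)).2 h.weight_summable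
  · intro k hk
    refine Set.indicator_of_notMem (fun hkA => ?_) _
    have := hA (k + 1) (by omega) hkA
    have := Finset.mem_range.1 hk
    omega

lemma total_pos : 0 < ∑' n, p (n + 1) :=
  h.summable_shift.tsum_pos h.weight_shift_nonneg 0 (h.weight_pos _ le_rfl)

lemma sequenceMeasure_apply {A : Set ℝ} (hA : MeasurableSet A) :
    sequenceMeasure x p A = ENNReal.ofReal ((∑' n, p (n + 1))⁻¹ * pointMass x p A) := by
  rw [ENNReal.ofReal_mul (inv_nonneg.2 h.total_pos.le), ENNReal.ofReal_inv_of_pos h.total_pos,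
    ENNReal.ofReal_tsum_of_nonneg h.weight_shift_nonneg h.summable_shift, pointMass,
    ENNReal.ofReal_tsum_of_nonneg (h.indicator_nonneg A) (h.summable_indicator A),
    sequenceMeasure, Measure.smul_apply, Measure.sum_apply _ hA, smul_eq_mul]
  congr 2
  ext n
  by_cases hn : x (n + 1) ∈ A <;> simp [hA, hn, Set.indicator]

lemma sequenceMeasure_real {A : Set ℝ} (hA : MeasurableSet A) :
    (sequenceMeasure x p).real A = (∑' n, p (n + 1))⁻¹ * pointMass x p A := by
  rw [Measure.real, h.sequenceMeasure_apply hA, ENNReal.toReal_ofReal]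
  exact mul_nonneg (inv_nonneg.2 h.total_pos.le) (h.pointMass_nonneg A)

/-- The normalising factor is positive and cancels, so the inequalities defining doubling and
regularity become real inequalities between weights. -/
lemma sequenceMeasure_le_iff {A B : Set ℝ} (hA : MeasurableSet A) (hB : MeasurableSet B)
    {K : ℝ} (hK : 0 ≤ K) :
    sequenceMeasure x p A ≤ ENNReal.ofReal K * sequenceMeasure x p B ↔
      pointMass x p A ≤ K * pointMass x p B := by
  have hS := inv_pos.2 h.total_pos
  rw [h.sequenceMeasure_apply hA, h.sequenceMeasure_apply hB, ← ENNReal.ofReal_mul hK,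
    ENNReal.ofReal_le_ofReal_iff
      (mul_nonneg hK (mul_nonneg hS.le (h.pointMass_nonneg B))),
    show K * ((∑' n, p (n + 1))⁻¹ * pointMass x p B) =
      (∑' n, p (n + 1))⁻¹ * (K * pointMass x p B) by ring, mul_le_mul_iff_right₀ hS]

lemma mem_support_iff {y : ℝ} :
    y ∈ (sequenceMeasure x p).support ↔ y = 0 ∨ ∃ n, 1 ≤ n ∧ y = x n := by
  have hpos : ∀ A : Set ℝ, MeasurableSet A → ∀ n, 1 ≤ n → x n ∈ A → 0 < sequenceMeasure x p A := by
    intro A hA n hn hnA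
    rw [h.sequenceMeasure_apply hA, ENNReal.ofReal_pos]
    exact mul_pos (inv_pos.2 h.total_pos)
      ((h.weight_pos n hn).trans_le (h.weight_le_pointMass hn hnA))
  constructor
  · intro hy
    -- The points together with their limit 0 form a compact set of full measure, so the support
    -- lies inside it.
    have hc : IsClosed (insert 0 (Set.range fun n => x (n + 1))) :=
      (((tendsto_add_atTop_iff_nat 1).2 h.point_tendsto).isCompact_insert_range).isClosed
    have hae : insert 0 (Set.range fun n => x (n + 1)) ∈ ae (sequenceMeasure x p) := by
      rw [mem_ae_iff, h.sequenceMeasure_apply hc.measurableSet.compl]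
      have : pointMass x p (insert 0 (Set.range fun n => x (n + 1)))ᶜ = 0 := by
        rw [pointMass, ← tsum_zero (α := ℝ) (β := ℕ)]
        congr 1
        ext n
        exact Set.indicator_of_notMem (by simp) _
      rw [this]; simp
    rcases Measure.support_subset_of_isClosed hc hae hy with rfl | ⟨n, rfl⟩
    · exact Or.inl rfl
    · exact Or.inr ⟨n + 1, by omega, rfl⟩
  · intro hy
    rw [Metric.nhds_basis_ball.mem_measureSupport]
    intro r hr
    rcases hy with rfl | ⟨n, hn, rfl⟩
    · obtain ⟨n, hn, hn1⟩ := ((h.point_tendsto.eventually (Metric.ball_mem_nhds 0 hr)).and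
        (eventually_ge_atTop 1)).exists
      exact hpos _ Metric.isOpen_ball.measurableSet n hn1 hn
    · exact hpos _ Metric.isOpen_ball.measurableSet n hn (Metric.mem_ball_self hr)

lemma zero_mem_support : (0 : ℝ) ∈ (sequenceMeasure x p).support :=
  h.mem_support_iff.2 (Or.inl rfl)

lemma point_mem_support {n : ℕ} (hn : 1 ≤ n) : x n ∈ (sequenceMeasure x p).support :=
  h.mem_support_iff.2 (Or.inr ⟨n, hn, rfl⟩)

lemma upperRegularityDim_le {s C : ℝ} (hs : 0 ≤ s) (hC : 0 < C)
    (H : ∀ r R : ℝ, 0 < r → r < R → ∀ y ∈ (sequenceMeasure x p).support,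
      pointMass x p (Metric.ball y R) ≤ C * (R / r) ^ s * pointMass x p (Metric.ball y r)) :
    upperRegularityDim (sequenceMeasure x p) ≤ s := by
  refine sInf_le ⟨s, ⟨hs, C, hC, fun r R hr hrR y hy => ?_⟩, rfl⟩
  rw [h.sequenceMeasure_le_iff Metric.isOpen_ball.measurableSet Metric.isOpen_ball.measurableSet]
  · exact H r R hr hrR y hy
  · have := hr.trans hrR
    positivity

lemma le_upperRegularityDim {t : EReal}
    (H : ∀ s C : ℝ, 0 ≤ s → 0 < C → (∀ r R : ℝ, 0 < r → r < R →
      ∀ y ∈ (sequenceMeasure x p).support,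
      pointMass x p (Metric.ball y R) ≤ C * (R / r) ^ s * pointMass x p (Metric.ball y r)) →
      t ≤ s) :
    t ≤ upperRegularityDim (sequenceMeasure x p) := by
  refine le_sInf ?_
  rintro _ ⟨s, ⟨hs, C, hC, hH⟩, rfl⟩
  refine H s C hs hC fun r R hr hrR y hy => ?_
  have := hH r R hr hrR y hy
  rwa [h.sequenceMeasure_le_iff Metric.isOpen_ball.measurableSet
    Metric.isOpen_ball.measurableSet] at this
  have := hr.trans hrR
  positivity

/-- If the mass ratio of concentric balls is unbounded for a fixed ratio of the radii, then the
measure is not doubling and its upper regularity dimension is infinite. -/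
lemma not_isDoublingMeas_and_upperRegularityDim_eq_top {k : ℝ} (hk : 1 < k)
    (H : ∀ C : ℝ, ∃ y ∈ (sequenceMeasure x p).support, ∃ r > 0,
      C * pointMass x p (Metric.ball y r) < pointMass x p (Metric.ball y (k * r))) :
    ¬ IsDoublingMeas (sequenceMeasure x p) ∧
      upperRegularityDim (sequenceMeasure x p) = ⊤ := by
  constructor
  · rintro ⟨C, hC, hD⟩
    -- Since 2^j > k, applying the doubling bound j times controls the dilation by k with constant
    -- C^j.
    obtain ⟨j, hj⟩ := pow_unbounded_of_one_lt k one_lt_two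
    obtain ⟨y, hy, r, hr, hlt⟩ := H (C ^ j)
    have hiter : ∀ i : ℕ, pointMass x p (Metric.ball y (2 ^ i * r)) ≤
        C ^ i * pointMass x p (Metric.ball y r) := by
      intro i
      induction i with
      | zero => simp
      | succ i ih =>
        have h1 := hD (2 ^ (i + 1) * r) (by positivity) y hy
        rw [h.sequenceMeasure_le_iff Metric.isOpen_ball.measurableSet
          Metric.isOpen_ball.measurableSet hC.le,
          show 2 ^ (i + 1) * r / 2 = 2 ^ i * r by ring] at h1
        calc _ ≤ _ := h1
          _ ≤ C * (C ^ i * pointMass x p (Metric.ball y r)) := by gcongr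
          _ = _ := by ring
    have h2 := h.pointMass_mono (Metric.ball_subset_ball
      (show k * r ≤ 2 ^ j * r by gcongr) : Metric.ball y (k * r) ⊆ _)
    linarith [hiter j]
  · refine top_le_iff.1 (h.le_upperRegularityDim fun s C hs hC hH => ?_)
    obtain ⟨y, hy, r, hr, hlt⟩ := H (C * k ^ s)
    have := hH r (k * r) hr (by nlinarith) y hy
    rw [mul_div_cancel_right₀ _ hr.ne'] at this
    linarith

end IsMassSequence

end PointMass

/-! ### Consequences of a power law for the mass near zero. -/

/-- If `f r` is comparable to `r ^ t` as `r → 0`, then `log (f r) / log r → t`. -/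
lemma tendsto_log_div_log_of_comparable {f : ℝ → ℝ} {t c C : ℝ} (hc : 0 < c)
    (h1 : ∀ᶠ r in 𝓝[>] (0 : ℝ), c * r ^ t ≤ f r) (h2 : ∀ᶠ r in 𝓝[>] (0 : ℝ), f r ≤ C * r ^ t) :
    Tendsto (fun r => Real.log (f r) / Real.log r) (𝓝[>] 0) (𝓝 t) := by
  have hlim : ∀ a : ℝ, Tendsto (fun r => Real.log a / Real.log r + t) (𝓝[>] 0) (𝓝 t) := by
    intro a
    simpa using ((Real.tendsto_log_nhdsGT_zero.const_div_atBot (Real.log a)).add_const t)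
  have hsmall : ∀ᶠ r in 𝓝[>] (0 : ℝ), r ∈ Set.Ioo (0 : ℝ) 1 := Ioo_mem_nhdsGT one_pos
  -- Since log r < 0 for r < 1, the upper bound on f bounds the quotient from below, and conversely.
  refine tendsto_of_tendsto_of_tendsto_of_le_of_le' (hlim C) (hlim c) ?_ ?_
  · filter_upwards [h1, h2, hsmall] with r h1 h2 hr
    have hp := Real.rpow_pos_of_pos hr.1 t
    have hf : 0 < f r := (mul_pos hc hp).trans_le h1
    have hC : 0 < C := by
      by_contra! hC
      nlinarith
    have hl := Real.log_neg hr.1 hr.2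
    have := Real.log_le_log hf h2
    rw [Real.log_mul hC.ne' hp.ne', Real.log_rpow hr.1] at this
    rw [le_div_iff_of_neg hl, add_mul, div_mul_cancel₀ _ hl.ne]
    exact this
  · filter_upwards [h1, hsmall] with r h1 hr
    have hp := Real.rpow_pos_of_pos hr.1 t
    have hl := Real.log_neg hr.1 hr.2
    have := Real.log_le_log (mul_pos hc hp) h1
    rw [Real.log_mul hc.ne' hp.ne', Real.log_rpow hr.1] at this
    rw [div_le_iff_of_neg hl, add_mul, div_mul_cancel₀ _ hl.ne]
    exact this

lemma min_one_le_div_mul_min_one {r R : ℝ} (hr : 0 < r) (hrR : r ≤ R) :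
    min R 1 ≤ R / r * min r 1 := by
  have h1 : 1 ≤ R / r := (one_le_div hr).2 hrR
  rcases le_total r 1 with h | h
  · rw [min_eq_left h, div_mul_cancel₀ _ hr.ne']; exact min_le_left _ _
  · rw [min_eq_right h, mul_one]; exact (min_le_right _ _).trans h1

/-- The mass of the ball of radius `r` about zero is comparable to `r ^ t`, for `r` up to one. -/
def MassComparable (x p : ℕ → ℝ) (t : ℝ) : Prop :=
  ∃ c C : ℝ, 0 < c ∧ 0 < C ∧ ∀ r > 0, c * min r 1 ^ t ≤ pointMass x p (Metric.ball 0 r) ∧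
    pointMass x p (Metric.ball 0 r) ≤ C * min r 1 ^ t

namespace IsMassSequence

variable {x p : ℕ → ℝ} (h : IsMassSequence x p) {t : ℝ}
include h

lemma massComparable_of_le_one {c C : ℝ} (hc : 0 < c)
    (H : ∀ r > 0, r ≤ 1 → c * r ^ t ≤ pointMass x p (Metric.ball 0 r) ∧
      pointMass x p (Metric.ball 0 r) ≤ C * r ^ t) : MassComparable x p t := by
  have hu : 0 < pointMass x p Set.univ :=
    (h.weight_pos 1 le_rfl).trans_le (h.weight_le_pointMass le_rfl (Set.mem_univ _))
  have hC : c ≤ C := by simpa using (H 1 one_pos le_rfl).1.trans (H 1 one_pos le_rfl).2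
  -- Beyond radius 1 the mass is at most the total weight, which is therefore added to C.
  refine ⟨c, C + pointMass x p Set.univ, hc, by linarith, fun r hr => ?_⟩
  rcases le_total r 1 with h1 | h1
  · rw [min_eq_left h1]
    refine ⟨(H r hr h1).1, (H r hr h1).2.trans ?_⟩
    gcongr; linarith
  · rw [min_eq_right h1, Real.one_rpow, mul_one, mul_one]
    constructor
    · simpa using (H 1 one_pos le_rfl).1.trans
        (h.pointMass_mono (Metric.ball_subset_ball h1))
    · have := h.pointMass_mono (Set.subset_univ (Metric.ball 0 r)); linarith

/-- For r ≥ 2 x_n the ball about x_n contains B(0, r/2); the factor (1/2)^t pays for halving the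
radius. -/
lemma exists_le_pointMass_ball (hm : MassComparable x p t) (ht : 0 ≤ t) :
    ∃ c > 0, ∀ n, 1 ≤ n → ∀ r, 2 * x n ≤ r →
      c * min r 1 ^ t ≤ pointMass x p (Metric.ball (x n) r) := by
  obtain ⟨c, C, hc, hC, H⟩ := hm
  refine ⟨c * (1 / 2) ^ t, by positivity, fun n hn r hr => ?_⟩
  have hx := h.point_pos n hn
  have hr0 : 0 < r := by linarith
  have hsub : Metric.ball 0 (r / 2) ⊆ Metric.ball (x n) r := by
    refine Metric.ball_subset_ball' ?_
    rw [Real.dist_eq, zero_sub, abs_neg, abs_of_pos hx]; linarith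
  refine le_trans ?_ ((H (r / 2) (by linarith)).1.trans (h.pointMass_mono hsub))
  rw [mul_assoc, ← Real.mul_rpow (by norm_num) (by positivity)]
  gcongr
  refine le_min ?_ ?_
  · linarith [min_le_left r 1]
  · linarith [min_le_right r 1]

/-- For R ≥ k x_n the ball about x_n lies in B(0, (1 + 1/k) R). -/
lemma exists_pointMass_ball_le (hm : MassComparable x p t) (ht : 0 ≤ t) {k : ℝ} (hk : 0 < k) :
    ∃ C > 0, ∀ n, 1 ≤ n → ∀ R, k * x n ≤ R →
      pointMass x p (Metric.ball (x n) R) ≤ C * min R 1 ^ t := by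
  obtain ⟨c, C, hc, hC, H⟩ := hm
  refine ⟨C * (1 + 1 / k) ^ t, by positivity, fun n hn R hR => ?_⟩
  have hx := h.point_pos n hn
  have hR0 : 0 < R := (mul_pos hk hx).trans_le hR
  have hsub : Metric.ball (x n) R ⊆ Metric.ball 0 ((1 + 1 / k) * R) := by
    refine Metric.ball_subset_ball' ?_
    rw [Real.dist_eq, sub_zero, abs_of_pos hx]
    have : x n ≤ R / k := by rw [le_div_iff₀ hk]; linarith
    have h2 : (1 + 1 / k) * R = R + R / k := by ring
    linarith
  refine ((h.pointMass_mono hsub).trans (H _ (by positivity)).2).trans ?_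
  rw [mul_assoc, ← Real.mul_rpow (by positivity) (by positivity)]
  gcongr
  have h1 : 1 ≤ 1 + 1 / k := by have := div_pos one_pos hk; linarith
  have h2 := min_one_le_div_mul_min_one hR0 (show R ≤ (1 + 1 / k) * R by nlinarith)
  rwa [mul_div_cancel_right₀ _ hR0.ne'] at h2

/-- To bound the upper regularity dimension of a measure with power law at zero, it suffices to
control balls about the points `x n` of radius small compared to `x n`. -/
lemma upperRegularityDim_le_of_massComparable (hm : MassComparable x p t) (ht : 0 ≤ t)
    {s k D E : ℝ} (hts : t ≤ s) (hk : 0 < k) (hD : 0 < D) (hE : 0 < E)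
    (small : ∀ n, 1 ≤ n → ∀ r R, 0 < r → r < R → R ≤ k * x n →
      pointMass x p (Metric.ball (x n) R) ≤
        D * (R / r) ^ s * pointMass x p (Metric.ball (x n) r))
    (mid : ∀ n, 1 ≤ n → ∀ r, 0 < r → r ≤ 2 * x n →
      x n ^ t ≤ E * (x n / r) ^ s * pointMass x p (Metric.ball (x n) r)) :
    upperRegularityDim (sequenceMeasure x p) ≤ s := by
  have hs : 0 ≤ s := ht.trans hts
  obtain ⟨c₁, hc₁, H₁⟩ := h.exists_le_pointMass_ball hm ht
  obtain ⟨C₁, hC₁, H₂⟩ := h.exists_pointMass_ball_le hm ht hk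
  obtain ⟨C₂, hC₂, H₃⟩ := h.exists_pointMass_ball_le hm ht two_pos
  obtain ⟨c, C, hc, hC, H⟩ := hm
  -- When both masses are controlled by powers of min(·, 1), the bound holds with exponent t, and
  -- R/r ≥ 1 allows t to be raised to s.
  have key : ∀ {a b r R : ℝ} {A B : Set ℝ}, 0 < a → 0 < b → 0 < r → r < R →
      b * min r 1 ^ t ≤ pointMass x p B → pointMass x p A ≤ a * min R 1 ^ t →
      pointMass x p A ≤ a / b * (R / r) ^ s * pointMass x p B := by
    intro a b r R A B ha hb hr hrR hB hA
    have hR := hr.trans hrR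
    have h1 : 1 ≤ R / r := (one_le_div hr).2 hrR.le
    calc pointMass x p A ≤ a * min R 1 ^ t := hA
      _ ≤ a * (R / r * min r 1) ^ t := by
          gcongr; exact min_one_le_div_mul_min_one hr hrR.le
      _ = a / b * (R / r) ^ t * (b * min r 1 ^ t) := by
          rw [Real.mul_rpow (by positivity) (by positivity)]; field_simp
      _ ≤ a / b * (R / r) ^ s * pointMass x p B := by
          gcongr
  have lift : ∀ {a b r R : ℝ} {A B : Set ℝ}, a ≤ b → 0 < r → r < R →
      pointMass x p A ≤ a * (R / r) ^ s * pointMass x p B →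
      pointMass x p A ≤ b * (R / r) ^ s * pointMass x p B := by
    intro a b r R A B hab hr hrR hA
    have hR := hr.trans hrR
    have := h.pointMass_nonneg B
    exact hA.trans (by gcongr)
  have e1 : 0 < C / c := by positivity
  have e2 : 0 < C₂ / c₁ := by positivity
  have e3 : 0 < C₁ * E * k ^ (t - s) := by positivity
  refine h.upperRegularityDim_le hs
    (C := C / c + C₂ / c₁ + D + C₁ * E * k ^ (t - s)) (by positivity) fun r R hr hrR y hy => ?_
  have hR := hr.trans hrR
  rcases h.mem_support_iff.1 hy with rfl | ⟨n, hn, rfl⟩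
  · exact lift (by linarith) hr hrR (key hC hc hr hrR (H r hr).1 (H R hR).2)
  have hx := h.point_pos n hn
  rcases le_total (2 * x n) r with h2 | h2
  · exact lift (by linarith) hr hrR
      (key hC₂ hc₁ hr hrR (H₁ n hn r h2) (H₃ n hn R (h2.trans hrR.le)))
  rcases le_total R (k * x n) with h3 | h3
  · exact lift (by linarith) hr hrR (small n hn r R hr hrR h3)
  -- Here r ≤ 2 x_n and R ≥ k x_n, so the estimate passes through the scale x_n via R/r =
  -- (R/x_n)(x_n/r). Raising the exponent of R/(k x_n) ≥ 1 from t to s leaves the constant k^(t-s).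
  refine lift (a := C₁ * E * k ^ (t - s)) (by linarith) hr hrR ?_
  have hW := h.pointMass_nonneg (Metric.ball (x n) r)
  have h4 : 1 ≤ R / (k * x n) := (one_le_div (by positivity)).2 h3
  calc pointMass x p (Metric.ball (x n) R) ≤ C₁ * min R 1 ^ t := H₂ n hn R h3
    _ ≤ C₁ * R ^ t := by gcongr; exact min_le_left _ _
    _ = C₁ * k ^ t * (R / (k * x n)) ^ t * x n ^ t := by
        rw [Real.div_rpow hR.le (by positivity), Real.mul_rpow hk.le hx.le]; field_simp
    _ ≤ C₁ * k ^ t * (R / (k * x n)) ^ s *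
        (E * (x n / r) ^ s * pointMass x p (Metric.ball (x n) r)) := by
        gcongr
        exact mid n hn r hr h2
    _ = _ := by
        rw [Real.div_rpow hR.le (by positivity), Real.mul_rpow hk.le hx.le,
          Real.div_rpow hx.le hr.le, Real.div_rpow hR.le hr.le, Real.rpow_sub hk]
        field_simp

/-- At the origin with R = 1, an admissible exponent s gives c ≤ D C r^(t-s) for all small r, hence
t ≤ s. -/
lemma le_upperRegularityDim_of_massComparable (hm : MassComparable x p t) :
    (t : EReal) ≤ upperRegularityDim (sequenceMeasure x p) := by
  obtain ⟨c, C, hc, hC, H⟩ := hm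
  refine h.le_upperRegularityDim fun s D hs hD hH => ?_
  have h1 : t - s ≤ 0 := by
    refine exponent_nonpos_of_le_mul_rpow (u := id) (l := 𝓝[>] 0) (K := D * C)
      (tendsto_id.mono_left nhdsWithin_le_nhds) hc ?_
    filter_upwards [Ioo_mem_nhdsGT one_pos] with r hr
    have h2 := hH r 1 hr.1 hr.2 0 h.zero_mem_support
    have h3 := (H 1 one_pos).1
    have h4 := (H r hr.1).2
    rw [min_self, Real.one_rpow, mul_one] at h3
    rw [min_eq_left hr.2.le] at h4
    have hr0 := hr.1
    calc c ≤ _ := h3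
      _ ≤ _ := h2
      _ ≤ D * (1 / r) ^ s * (C * r ^ t) := by gcongr
      _ = D * C * id r ^ (t - s) := by
        rw [one_div, Real.inv_rpow hr0.le, id, Real.rpow_sub hr0]; field_simp
  exact_mod_cast sub_nonpos.1 h1

lemma upperLocalDim_eq {y c C : ℝ} (hc : 0 < c)
    (H : ∀ r > 0, r ≤ 1 → c * r ^ t ≤ pointMass x p (Metric.ball y r) ∧
      pointMass x p (Metric.ball y r) ≤ C * r ^ t) :
    upperLocalDim (sequenceMeasure x p) y = t := by
  have hS := inv_pos.2 h.total_pos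
  have hsmall : ∀ᶠ r in 𝓝[>] (0 : ℝ), r ∈ Set.Ioo (0 : ℝ) 1 := Ioo_mem_nhdsGT one_pos
  refine Tendsto.limsup_eq ((continuous_coe_real_ereal.tendsto t).comp
    (tendsto_log_div_log_of_comparable (c := (∑' n, p (n + 1))⁻¹ * c)
      (C := (∑' n, p (n + 1))⁻¹ * C) (mul_pos hS hc) ?_ ?_))
  · filter_upwards [hsmall] with r hr
    rw [h.sequenceMeasure_real Metric.isOpen_ball.measurableSet, mul_assoc]
    exact mul_le_mul_of_nonneg_left (H r hr.1 hr.2.le).1 hS.le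
  · filter_upwards [hsmall] with r hr
    rw [h.sequenceMeasure_real Metric.isOpen_ball.measurableSet, mul_assoc]
    exact mul_le_mul_of_nonneg_left (H r hr.1 hr.2.le).2 hS.le

/-- Each x_n is an atom and has local dimension 0, so the supremum is attained at the origin. -/
lemma iSup_upperLocalDim_eq (hm : MassComparable x p t) (ht : 0 ≤ t) :
    (⨆ y ∈ (sequenceMeasure x p).support, upperLocalDim (sequenceMeasure x p) y) = t := by
  obtain ⟨c, C, hc, hC, H⟩ := hm
  have h0 : upperLocalDim (sequenceMeasure x p) 0 = t := by
    refine h.upperLocalDim_eq (C := C) hc fun r hr hr1 => ?_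
    simpa [min_eq_left hr1] using H r hr
  refine le_antisymm (iSup₂_le fun y hy => ?_) ?_
  · rcases h.mem_support_iff.1 hy with rfl | ⟨n, hn, rfl⟩
    · exact h0.le
    · rw [h.upperLocalDim_eq (t := 0) (c := p n) (C := pointMass x p Set.univ)
        (h.weight_pos n hn)]
      · exact_mod_cast ht
      · intro r hr hr1
        rw [Real.rpow_zero, mul_one, mul_one]
        exact ⟨h.weight_le_pointMass hn (Metric.mem_ball_self hr),
          h.pointMass_mono (Set.subset_univ _)⟩
  · rw [← h0]
    exact le_iSup₂ (f := fun y _ => upperLocalDim (sequenceMeasure x p) y) 0 h.zero_mem_support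

end IsMassSequence

/-! ### Covering numbers and the Assouad dimension on the line. -/

/-- A finite cover bounds the external covering number. -/
lemma externalCoveringNumber_le_ofReal {X : Type*} [PseudoMetricSpace X] {r : ℝ≥0} {A : Set X}
    {s : Finset X} {K : ℝ} (hK : (s.card : ℝ) ≤ K) (hs : ∀ z ∈ A, ∃ y ∈ s, dist z y ≤ r) :
    ((Metric.externalCoveringNumber r A : ℕ∞) : ℝ≥0∞) ≤ ENNReal.ofReal K := by
  have hcov : Metric.IsCover r A (s : Set X) := by
    intro z hz
    obtain ⟨y, hy, hzy⟩ := hs z hz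
    exact ⟨y, hy, edist_le_coe.2 (NNReal.coe_le_coe.1 hzy)⟩
  have h1 := hcov.externalCoveringNumber_le_encard
  rw [Set.encard_coe_eq_coe_finsetCard] at h1
  calc _ ≤ (((s.card : ℕ∞)) : ℝ≥0∞) := by exact_mod_cast h1
    _ = ENNReal.ofReal (s.card : ℝ) := by simp
    _ ≤ _ := ENNReal.ofReal_le_ofReal hK

lemma assouadDim_nonneg {X : Type*} [PseudoMetricSpace X] (F : Set X) : 0 ≤ assouadDim F := by
  refine le_sInf ?_
  rintro _ ⟨s, ⟨hs, -⟩, rfl⟩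
  exact EReal.coe_nonneg.2 hs

lemma assouadDim_real_le_one (F : Set ℝ) : assouadDim F ≤ 1 := by
  -- The cover is a grid of step r with 2K + 1 centres, where K < R/r + 1; since R/r ≥ 1, this is at
  -- most 5 R/r.
  refine sInf_le ⟨1, ⟨zero_le_one, 5, by norm_num, fun r R hr hrR x _ => ?_⟩, rfl⟩
  have hr' : (0 : ℝ) < r := hr
  rw [Real.rpow_one]
  have h1 : 1 ≤ R / r := (one_le_div hr').2 hrR.le
  set K : ℕ := ⌈R / r⌉₊ with hKdef
  have hK1 : R / r ≤ K := Nat.le_ceil _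
  have hK2 : (K : ℝ) < R / r + 1 := Nat.ceil_lt_add_one (by linarith)
  refine externalCoveringNumber_le_ofReal
    (s := (Finset.Icc (-(K : ℤ)) K).image fun k : ℤ => x + k * r) ?_ ?_
  · have hcard : ((Finset.Icc (-(K : ℤ)) K).card : ℝ) = 2 * K + 1 := by
      rw [Int.card_Icc, show ((K : ℤ) + 1 - -(K : ℤ)) = ((2 * K + 1 : ℕ) : ℤ) by push_cast; ring,
        Int.toNat_natCast]
      push_cast; ring
    have := Nat.cast_le (α := ℝ).2 (Finset.card_image_le (s := Finset.Icc (-(K : ℤ)) K)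
      (f := fun k : ℤ => x + k * (r : ℝ)))
    linarith
  · rintro z ⟨-, hz⟩
    rw [Metric.mem_ball, Real.dist_eq, abs_lt] at hz
    have h2 : (z - x) / r < K := lt_of_lt_of_le (by gcongr; linarith) hK1
    have h3 : -(K : ℝ) ≤ (z - x) / r := by
      rw [le_div_iff₀ hr']
      rw [div_le_iff₀ hr'] at hK1
      linarith
    have h4 := Int.floor_le ((z - x) / r)
    have h5 := Int.lt_floor_add_one ((z - x) / r)
    refine ⟨_, Finset.mem_image.2 ⟨⌊(z - x) / r⌋, Finset.mem_Icc.2 ⟨?_, ?_⟩, rfl⟩, ?_⟩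
    · exact Int.le_floor.2 (by exact_mod_cast h3)
    · exact Int.floor_le_iff.2 (by push_cast; linarith)
    · rw [le_div_iff₀ hr'] at h4
      rw [div_lt_iff₀ hr'] at h5
      rw [Real.dist_eq, abs_le]
      constructor <;> linarith

/-! ### Exponentially converging points. -/

section Geometric

variable {l w : ℝ} {p : ℕ → ℝ}

lemma isMassSequence_geometric (hl0 : 0 < l) (hl1 : l < 1) (hp : ∀ n, 1 ≤ n → 0 < p n)
    (hps : Summable p) : IsMassSequence (fun n => l ^ n) p where
  point_pos n _ := pow_pos hl0 n
  point_anti _ _ _ hmn := pow_le_pow_of_le_one hl0.le hl1.le hmn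
  point_tendsto := tendsto_pow_atTop_nhds_zero_of_lt_one hl0.le hl1
  weight_pos := hp
  weight_summable := hps

lemma tsum_geometric_tail (hw0 : 0 < w) (hw1 : w < 1) (N : ℕ) :
    ∑' k, w ^ (N + k) = w ^ N / (1 - w) := by
  simp_rw [pow_add, tsum_mul_left, tsum_geometric_of_lt_one hw0.le hw1, div_eq_mul_inv]

/-- Distinct terms of a geometric sequence are separated in proportion to their size. -/
lemma geometric_gap (hl0 : 0 < l) (hl1 : l < 1) {m n : ℕ} (hmn : m ≠ n) :
    (1 - l) * l ^ n ≤ |l ^ m - l ^ n| := by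
  have hn := pow_pos hl0 n
  have hm := pow_pos hl0 m
  rcases lt_or_gt_of_ne hmn with h | h
  · have h1 : l ^ n ≤ l ^ m * l := by
      rw [← pow_succ]; exact pow_le_pow_of_le_one hl0.le hl1.le h
    have h2 := pow_le_pow_of_le_one hl0.le hl1.le h.le
    refine le_trans ?_ (le_abs_self _)
    nlinarith
  · have h1 : l ^ m ≤ l ^ n * l := by
      rw [← pow_succ]; exact pow_le_pow_of_le_one hl0.le hl1.le h
    refine le_trans ?_ (neg_le_abs _)
    nlinarith

lemma geometric_mem_ball_iff (hl0 : 0 < l) (hl1 : l < 1) {m n : ℕ} {R : ℝ}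
    (hR : R ≤ (1 - l) * l ^ n) (hm : l ^ m ∈ Metric.ball (l ^ n) R) : m = n := by
  by_contra hmn
  rw [Metric.mem_ball, Real.dist_eq] at hm
  linarith [geometric_gap hl0 hl1 hmn]

/-- The exponent log w / log l is exactly the one turning the points l^n into the weights w^n. -/
lemma pow_rpow_log_div_log (hl0 : 0 < l) (hl1 : l < 1) (hw0 : 0 < w) (n : ℕ) :
    (l ^ n) ^ (Real.log w / Real.log l) = w ^ n := by
  rw [Real.rpow_def_of_pos (pow_pos hl0 n), Real.log_pow,
    show (n : ℝ) * Real.log l * (Real.log w / Real.log l) = n * Real.log w by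
      field_simp [(Real.log_neg hl0 hl1).ne], ← Real.log_pow, Real.exp_log (pow_pos hw0 n)]

lemma massComparable_geometric (hl0 : 0 < l) (hl1 : l < 1) (hw0 : 0 < w) (hw1 : w < 1) :
    MassComparable (fun n => l ^ n) (fun n => w ^ n) (Real.log w / Real.log l) := by
  have h := isMassSequence_geometric (p := fun n => w ^ n) hl0 hl1 (fun n _ => pow_pos hw0 n)
    (summable_geometric_of_lt_one hw0.le hw1)
  have ht : 0 ≤ Real.log w / Real.log l :=
    div_nonneg_of_nonpos (Real.log_neg hw0 hw1).le (Real.log_neg hl0 hl1).le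
  have h1w : 0 < 1 - w := by linarith
  refine h.massComparable_of_le_one (c := w / (1 - w)) (C := 1 / (1 - w)) (by positivity)
    fun r hr hr1 => ?_
  -- With l^(n+1) < r ≤ l^n, the open ball B(0,r) contains exactly the points of index at least n +
  -- 1.
  obtain ⟨n, hn1, hn2⟩ := exists_nat_pow_near_of_lt_one hr hr1 hl0 hl1
  have hball : ∀ m, l ^ m ∈ Metric.ball (0 : ℝ) r ↔ l ^ m < r := fun m => by
    rw [Metric.mem_ball, Real.dist_eq, sub_zero, abs_of_pos (pow_pos hl0 m)]
  constructor
  · refine le_trans ?_ (h.tail_le_pointMass (N := n + 1) (by omega) fun m hm =>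
      (hball m).2 ((pow_le_pow_of_le_one hl0.le hl1.le hm).trans_lt hn1))
    rw [tsum_geometric_tail hw0 hw1, pow_succ]
    have := Real.rpow_le_rpow hr.le hn2 ht
    rw [pow_rpow_log_div_log hl0 hl1 hw0] at this
    rw [div_mul_eq_mul_div, mul_comm]
    gcongr
  · refine (h.pointMass_le_tail (N := n + 1) (by omega) fun m _ hm => ?_).trans ?_
    · by_contra! hmn
      have := pow_le_pow_of_le_one hl0.le hl1.le (show m ≤ n by omega)
      linarith [(hball m).1 hm]
    rw [tsum_geometric_tail hw0 hw1]
    have := Real.rpow_le_rpow (pow_pos hl0 _).le hn1.le ht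
    rw [pow_rpow_log_div_log hl0 hl1 hw0] at this
    rw [div_mul_eq_mul_div, one_mul]
    gcongr

lemma upperRegularityDim_geometric (hl0 : 0 < l) (hl1 : l < 1) (hw0 : 0 < w) (hw1 : w < 1) :
    upperRegularityDim (sequenceMeasure (fun n => l ^ n) (fun n => w ^ n)) =
      ((Real.log w / Real.log l : ℝ) : EReal) := by
  have h := isMassSequence_geometric (p := fun n => w ^ n) hl0 hl1 (fun n _ => pow_pos hw0 n)
    (summable_geometric_of_lt_one hw0.le hw1)
  have hm := massComparable_geometric hl0 hl1 hw0 hw1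
  have ht : 0 ≤ Real.log w / Real.log l :=
    div_nonneg_of_nonpos (Real.log_neg hw0 hw1).le (Real.log_neg hl0 hl1).le
  refine le_antisymm ?_ (h.le_upperRegularityDim_of_massComparable hm)
  set t := Real.log w / Real.log l with htdef
  -- Up to radius (1 - l) l^n the ball contains only its centre, so the mass is constant and `D` =
  -- 1. For `mid`, x_n^t equals the weight of x_n, and (2 x_n / r)^t ≥ 1 explains `E` = 2^t.
  refine h.upperRegularityDim_le_of_massComparable hm ht le_rfl (k := 1 - l) (D := 1)
    (E := 2 ^ t) (by linarith) one_pos (by positivity) ?_ ?_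
  · intro n hn r R hr hrR hR
    have h1 : pointMass (fun n => l ^ n) (fun n => w ^ n) (Metric.ball (l ^ n) R) ≤
        (({n} : Finset ℕ).card : ℝ) * w ^ n := by
      refine pointMass_le_card_mul (pow_pos hw0 n).le fun m hm1 hmR => ?_
      have := geometric_mem_ball_iff hl0 hl1 hR hmR
      subst this
      exact ⟨Finset.mem_singleton_self _, le_rfl⟩
    rw [Finset.card_singleton, Nat.cast_one, one_mul] at h1
    have h2 := h.weight_le_pointMass hn (Metric.mem_ball_self hr)
    have h3 : 1 ≤ (R / r) ^ t := Real.one_le_rpow ((one_le_div hr).2 hrR.le) ht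
    have h4 := h.pointMass_nonneg (Metric.ball (l ^ n) r)
    calc _ ≤ _ := h1
      _ ≤ _ := h2
      _ ≤ _ := by rw [one_mul]; exact le_mul_of_one_le_left h4 h3
  · intro n hn r hr hr2
    have hx := pow_pos hl0 n
    have h2 := h.weight_le_pointMass hn (Metric.mem_ball_self hr)
    have h4 := h.pointMass_nonneg (Metric.ball (l ^ n) r)
    rw [← Real.mul_rpow two_pos.le (by positivity)]
    rw [htdef, pow_rpow_log_div_log hl0 hl1 hw0 n, ← htdef]
    refine h2.trans (le_mul_of_one_le_left h4 (Real.one_le_rpow ?_ ht))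
    rw [← mul_div_assoc]
    exact (one_le_div hr).2 hr2

/-- The point 0 covers everything below r, and the remaining points, apart from y itself, have size
between r and a multiple of R. There are O(1 + log(R/r)) of them, which is O((R/r)^s) for every s >
0. -/
lemma assouadDim_support_geometric (hl0 : 0 < l) (hl1 : l < 1) (hp : ∀ n, 1 ≤ n → 0 < p n)
    (hps : Summable p) : assouadDim (sequenceMeasure (fun n => l ^ n) p).support = 0 := by
  have h := isMassSequence_geometric hl0 hl1 hp hps
  have h1l : 0 < 1 - l := by linarith
  have hll := Real.log_neg hl0 hl1
  refine le_antisymm (EReal.le_of_forall_lt_iff_le.1 fun s hs => ?_) (assouadDim_nonneg _)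
  have hs : 0 < s := by exact_mod_cast hs
  -- A point of B(y,R) other than y is at most K R: if y = l^n, the gap (1 - l) l^n is below R, so y
  -- ≤ R/(1 - l).
  set K : ℝ := 1 + 1 / (1 - l) with hK
  have hK1 : 1 < K := by have := div_pos one_pos h1l; linarith
  -- The first term comes from log u ≤ u^s / s; the 3 counts the extra centres 0 and y and the unit
  -- excess in counting integers of an interval.
  refine sInf_le ⟨s, ⟨hs.le, K ^ s / s / -Real.log l + 3,
    add_pos (div_pos (by positivity) (by linarith)) (by norm_num), fun r R hr hrR y hy => ?_⟩, rfl⟩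
  have hr' : (0 : ℝ) < r := hr
  have hR := hr'.trans hrR
  have hlog : Real.log r ≤ Real.log (K * R) := Real.log_le_log hr' (by nlinarith)
  obtain ⟨S, hS, hcard⟩ := exists_finset_nat_mem_Icc
    (div_le_div_of_nonpos_of_le hll.le hlog)
  refine externalCoveringNumber_le_ofReal (s := insert 0 (insert y (S.image fun m => l ^ m))) ?_ ?_
  · have h1 : ((insert 0 (insert y (S.image fun m => l ^ m))).card : ℝ) ≤ S.card + 1 + 1 := by
      have := (Finset.card_insert_le 0 (insert y (S.image fun m => l ^ m))).trans
        (Nat.add_le_add_right ((Finset.card_insert_le y (S.image fun m => l ^ m)).trans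
          (Nat.add_le_add_right Finset.card_image_le 1)) 1)
      exact_mod_cast this
    have h2 : Real.log r / Real.log l - Real.log (K * R) / Real.log l =
        Real.log (K * (R / r)) / -Real.log l := by
      rw [← mul_div_assoc, Real.log_div (by positivity) hr'.ne', div_neg, ← sub_div, ← neg_div]
      ring
    have h3 : Real.log (K * (R / r)) / -Real.log l ≤ (K * (R / r)) ^ s / s / -Real.log l := by
      have : 0 < -Real.log l := by linarith
      gcongr
      exact Real.log_le_rpow_div (by positivity) hs
    have h4 : 1 ≤ (R / r) ^ s := Real.one_le_rpow ((one_le_div hr').2 hrR.le) hs.le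
    have h5 : (K * (R / r)) ^ s / s / -Real.log l = K ^ s / s / -Real.log l * (R / r) ^ s := by
      rw [Real.mul_rpow (by positivity) (by positivity)]; ring
    rw [h2] at hcard
    rw [add_mul]
    linarith
  · rintro z ⟨hz, hzR⟩
    rcases h.mem_support_iff.1 hz with rfl | ⟨m, hm, rfl⟩
    · exact ⟨0, Finset.mem_insert_self _ _, by simp⟩
    have hzpos := pow_pos hl0 m
    rcases le_total (l ^ m) r with hmr | hmr
    · exact ⟨0, Finset.mem_insert_self _ _, by
        rwa [Real.dist_eq, sub_zero, abs_of_pos hzpos]⟩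
    by_cases hzy : l ^ m = y
    · exact ⟨y, by simp, by simp [hzy]⟩
    have hKR : l ^ m ≤ K * R := by
      rcases h.mem_support_iff.1 hy with rfl | ⟨n, hn, rfl⟩
      · rw [Metric.mem_ball, Real.dist_eq, sub_zero, abs_of_pos hzpos] at hzR
        nlinarith
      · have hgap := geometric_gap hl0 hl1 (m := m) (n := n) (by rintro rfl; exact hzy rfl)
        rw [Metric.mem_ball, Real.dist_eq] at hzR
        have h1 : l ^ n ≤ R / (1 - l) := by
          rw [le_div_iff₀ h1l]; linarith
        have h2 : K * R = R + R / (1 - l) := by rw [hK]; ring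
        have := (abs_lt.1 hzR).2
        linarith
    refine ⟨l ^ m, Finset.mem_insert_of_mem (Finset.mem_insert_of_mem
      (Finset.mem_image_of_mem _ (hS m ?_ ?_))), by simp⟩
    · rw [div_le_iff_of_neg hll, ← Real.log_pow]
      exact Real.log_le_log hzpos hKR
    · rw [le_div_iff_of_neg hll, ← Real.log_pow]
      exact Real.log_le_log hr' hmr

end Geometric

/-! ### Polynomially converging points. -/

section Power

variable {l w : ℝ} {p : ℕ → ℝ}

lemma isMassSequence_power (hl : 0 < l) (hp : ∀ n, 1 ≤ n → 0 < p n) (hps : Summable p) :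
    IsMassSequence (fun n => (n : ℝ) ^ (-l)) p where
  point_pos n hn := Real.rpow_pos_of_pos (Nat.cast_pos.2 hn) _
  point_anti _ _ hm hmn := Real.rpow_le_rpow_of_nonpos (Nat.cast_pos.2 hm) (Nat.cast_le.2 hmn)
    (by linarith)
  point_tendsto := (tendsto_rpow_neg_atTop hl).comp tendsto_natCast_atTop_atTop
  weight_pos := hp
  weight_summable := hps

lemma summable_rpow_neg (hw : 1 < w) : Summable (fun n : ℕ => (n : ℝ) ^ (-w)) :=
  Real.summable_nat_rpow.2 (by linarith)

lemma rpow_neg_pos_of_one_le (w : ℝ) (n : ℕ) (hn : 1 ≤ n) : 0 < (n : ℝ) ^ (-w) :=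
  Real.rpow_pos_of_pos (Nat.cast_pos.2 hn) _

lemma hasSum_telescope_rpow_neg {a : ℝ} (ha : 0 < a) {N : ℕ} (hN : 1 ≤ N) :
    HasSum (fun k : ℕ => ((N + k : ℕ) : ℝ) ^ (-a) - ((N + (k + 1) : ℕ) : ℝ) ^ (-a))
      ((N : ℝ) ^ (-a)) := by
  rw [hasSum_iff_tendsto_nat_of_nonneg]
  · simp_rw [Finset.sum_range_sub' (fun k : ℕ => ((N + k : ℕ) : ℝ) ^ (-a))]
    have h1 : Tendsto (fun k : ℕ => ((N + k : ℕ) : ℝ) ^ (-a)) atTop (𝓝 0) :=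
      (tendsto_rpow_neg_atTop ha).comp (tendsto_natCast_atTop_atTop.comp
        (tendsto_atTop_mono (fun k => Nat.le_add_left k N) tendsto_id))
    simpa using h1.const_sub ((N : ℝ) ^ (-a))
  · intro k
    refine sub_nonneg.2 (Real.rpow_le_rpow_of_nonpos (by positivity) ?_ (by linarith))
    exact_mod_cast (by omega)

lemma summable_rpow_neg_tail (hw : 1 < w) (N : ℕ) :
    Summable (fun k : ℕ => ((N + k : ℕ) : ℝ) ^ (-w)) := by
  simpa only [add_comm N] using (summable_nat_add_iff N).2 (summable_rpow_neg hw)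

/-- The tangent at the left endpoint bounds each difference of the telescoping series of n^(1-w) by
(w-1) times the term n^(-w). -/
lemma le_tsum_rpow_neg_tail (hw : 1 < w) {N : ℕ} (hN : 1 ≤ N) :
    (N : ℝ) ^ (1 - w) / (w - 1) ≤ ∑' k : ℕ, ((N + k : ℕ) : ℝ) ^ (-w) := by
  have ha : 0 < w - 1 := by linarith
  have h1 := hasSum_telescope_rpow_neg ha hN
  rw [show 1 - w = -(w - 1) by ring, div_le_iff₀ ha, ← h1.tsum_eq, ← tsum_mul_right]
  refine h1.summable.tsum_le_tsum (fun k => ?_) ((summable_rpow_neg_tail hw N).mul_right _)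
  have h2 := rpow_neg_tangent_le ha (a := ((N + (k + 1) : ℕ) : ℝ)) (b := ((N + k : ℕ) : ℝ))
    (by positivity) (by positivity)
  rw [show -(w - 1) - 1 = -w by ring] at h2
  have h3 : ((N + (k + 1) : ℕ) : ℝ) - ((N + k : ℕ) : ℝ) = 1 := by push_cast; ring
  rw [h3] at h2
  linarith

/-- The tangent at the right endpoint compares the terms from index N + 1 on with the telescoping
series; the first term is bounded separately by N^(1-w). -/
lemma tsum_rpow_neg_tail_le (hw : 1 < w) {N : ℕ} (hN : 1 ≤ N) :
    ∑' k : ℕ, ((N + k : ℕ) : ℝ) ^ (-w) ≤ (1 + 1 / (w - 1)) * (N : ℝ) ^ (1 - w) := by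
  have ha : 0 < w - 1 := by linarith
  have h1 := hasSum_telescope_rpow_neg ha hN
  have hs := summable_rpow_neg_tail hw N
  rw [hs.tsum_eq_zero_add, add_mul, one_mul]
  have hN0 : (0 : ℝ) < N := Nat.cast_pos.2 hN
  gcongr
  · rw [add_zero]
    exact Real.rpow_le_rpow_of_exponent_le (by exact_mod_cast hN) (by linarith)
  · rw [show 1 - w = -(w - 1) by ring, ← h1.tsum_eq, ← tsum_mul_left]
    refine ((summable_nat_add_iff 1).2 hs).tsum_le_tsum (fun k => ?_) (h1.summable.mul_left _)
    have h2 := rpow_neg_tangent_le ha (a := ((N + k : ℕ) : ℝ)) (b := ((N + (k + 1) : ℕ) : ℝ))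
      (by positivity) (by positivity)
    rw [show -(w - 1) - 1 = -w by ring] at h2
    have h3 : ((N + k : ℕ) : ℝ) - ((N + (k + 1) : ℕ) : ℝ) = -1 := by push_cast; ring
    rw [h3] at h2
    rw [div_mul_eq_mul_div, one_mul, le_div_iff₀ ha]
    linarith

lemma massComparable_power (hl : 0 < l) (hw : 1 < w) :
    MassComparable (fun n => (n : ℝ) ^ (-l)) (fun n => (n : ℝ) ^ (-w)) ((w - 1) / l) := by
  have h := isMassSequence_power hl (rpow_neg_pos_of_one_le w) (summable_rpow_neg hw)
  have ha : 0 < w - 1 := by linarith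
  refine h.massComparable_of_le_one (c := 2 ^ (1 - w) / (w - 1)) (C := 1 + 1 / (w - 1))
    (by positivity) fun r hr hr1 => ?_
  -- The real index at which n^(-l) = r; the points of B(0,r) are those of index above q.
  set q := r ^ (-(1 / l)) with hq
  have hq1 : 1 ≤ q := Real.one_le_rpow_of_pos_of_le_one_of_nonpos hr hr1 (by
    have := div_pos one_pos hl; linarith)
  have hq0 : 0 < q := by linarith
  have hqr : q ^ (-l) = r := by
    rw [hq, ← Real.rpow_mul hr.le]
    rw [show -(1 / l) * -l = 1 by field_simp, Real.rpow_one]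
  have hqt : q ^ (1 - w) = r ^ ((w - 1) / l) := by
    rw [hq, ← Real.rpow_mul hr.le]
    congr 1; field_simp; ring
  have hball : ∀ m : ℕ, 1 ≤ m → ((m : ℝ) ^ (-l) ∈ Metric.ball (0 : ℝ) r ↔ q < m) := by
    intro m hm
    have hm0 : (0 : ℝ) < m := Nat.cast_pos.2 hm
    rw [Metric.mem_ball, Real.dist_eq, sub_zero, abs_of_pos (Real.rpow_pos_of_pos hm0 _)]
    nth_rw 1 [← hqr]
    exact Real.rpow_lt_rpow_iff_of_neg hm0 hq0 (by linarith)
  have hN1 : q < (⌊q⌋₊ + 1 : ℕ) := by exact_mod_cast Nat.lt_floor_add_one q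
  have hN2 : ((⌊q⌋₊ + 1 : ℕ) : ℝ) ≤ 2 * q := by
    push_cast; linarith [Nat.floor_le hq0.le]
  rw [← hqt]
  constructor
  · refine le_trans ?_ ((le_tsum_rpow_neg_tail hw (N := ⌊q⌋₊ + 1) (by omega)).trans
      (h.tail_le_pointMass (by omega) fun m hm => ?_))
    · rw [div_mul_eq_mul_div, ← Real.mul_rpow two_pos.le hq0.le]
      gcongr ?_ / _
      exact Real.rpow_le_rpow_of_nonpos (by positivity) hN2 (by linarith)
    · exact (hball m (by omega)).2 (hN1.trans_le (Nat.cast_le.2 hm))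
  · refine ((h.pointMass_le_tail (N := ⌊q⌋₊ + 1) (by omega) fun m hm hmr => ?_).trans
      (tsum_rpow_neg_tail_le hw (by omega))).trans ?_
    · exact Nat.succ_le_of_lt ((Nat.floor_lt hq0.le).2 ((hball m hm).1 hmr))
    · gcongr _ * ?_
      exact Real.rpow_le_rpow_of_nonpos hq0 hN1.le (by linarith)

lemma rpow_mul_rpow_neg_self {n : ℝ} (hn : 0 < n) (a : ℝ) : n ^ a * n ^ (-a) = 1 := by
  rw [← Real.rpow_add hn, add_neg_cancel, Real.rpow_zero]

/-- Lower bound for the mass of a ball about `n ^ (-l)`, of the order of the number of points. -/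
lemma exists_le_pointMass_ball_power (hl : 0 < l) (hw : 1 < w) :
    ∃ c > 0, ∀ n : ℕ, 1 ≤ n → ∀ r, 0 < r → r ≤ 2 * (n : ℝ) ^ (-l) →
      c * (1 + r * (n : ℝ) ^ (l + 1)) * (n : ℝ) ^ (-w) ≤
        pointMass (fun n => (n : ℝ) ^ (-l)) (fun n => (n : ℝ) ^ (-w))
          (Metric.ball ((n : ℝ) ^ (-l)) r) := by
  have h := isMassSequence_power hl (rpow_neg_pos_of_one_le w) (summable_rpow_neg hw)
  -- With d = c r n^(l+1), the bound 1/2 keeps d ≤ n, so the indices n, …, n + ⌊d⌋ stay below 2n and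
  -- their weights are at least (2n)^(-w). The bound 1/(2l) keeps these points within r/2 of n^(-l).
  set c : ℝ := min (1 / 2) (1 / (2 * l)) with hc
  have hc0 : 0 < c := lt_min (by norm_num) (by positivity)
  have hc1 : c ≤ 1 / 2 := min_le_left _ _
  have hc2 : c * (2 * l) ≤ 1 := by
    have := min_le_right (1 / 2) (1 / (2 * l))
    rwa [← hc, le_div_iff₀ (by positivity)] at this
  refine ⟨c / 2 * 2 ^ (-w), by positivity, fun n hn r hr hr2 => ?_⟩
  have hn0 : (0 : ℝ) < n := Nat.cast_pos.2 hn
  set g : ℝ := (n : ℝ) ^ (l + 1) with hg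
  have hg0 : 0 < g := by positivity
  have hg1 : g * (n : ℝ) ^ (-l - 1) = 1 := by
    rw [hg, show -l - 1 = -(l + 1) by ring]; exact rpow_mul_rpow_neg_self hn0 _
  have hg2 : g * (n : ℝ) ^ (-l) = n := by
    rw [hg, ← Real.rpow_add hn0, show l + 1 + -l = 1 by ring, Real.rpow_one]
  have hrg : r * g ≤ 2 * n := by nlinarith
  set d : ℝ := c * (r * g) with hd
  have hd0 : 0 ≤ d := by positivity
  have hdn : d ≤ n := by nlinarith
  have hfl := Nat.floor_le hd0
  have hfl' := Nat.lt_floor_add_one d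
  have hmem : ∀ m ∈ Finset.Icc n (n + ⌊d⌋₊), n ≤ m ∧ (m : ℝ) ≤ n + d := by
    intro m hm
    obtain ⟨h1, h2⟩ := Finset.mem_Icc.1 hm
    refine ⟨h1, ?_⟩
    have : (m : ℝ) ≤ n + ⌊d⌋₊ := by exact_mod_cast h2
    linarith
  have key := h.card_mul_le_pointMass (A := Metric.ball ((n : ℝ) ^ (-l)) r)
    (s := Finset.Icc n (n + ⌊d⌋₊)) (q := (2 * (n : ℝ)) ^ (-w)) ?_ ?_
  · refine le_trans ?_ key
    have hcard : ((Finset.Icc n (n + ⌊d⌋₊)).card : ℝ) = ⌊d⌋₊ + 1 := by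
      rw [Nat.card_Icc, show n + ⌊d⌋₊ + 1 - n = ⌊d⌋₊ + 1 by omega]; push_cast; ring
    rw [hcard, Real.mul_rpow two_pos.le hn0.le]
    have hpos : 0 < (2 : ℝ) ^ (-w) * (n : ℝ) ^ (-w) := by positivity
    calc c / 2 * 2 ^ (-w) * (1 + r * g) * (n : ℝ) ^ (-w)
        = ((c + d) / 2) * (2 ^ (-w) * (n : ℝ) ^ (-w)) := by rw [hd]; ring
      _ ≤ _ := by
        refine mul_le_mul_of_nonneg_right ?_ hpos.le
        have : (0 : ℝ) ≤ ⌊d⌋₊ := Nat.cast_nonneg _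
        linarith
  · intro m hm
    obtain ⟨h1, h2⟩ := hmem m hm
    have hm0 : (0 : ℝ) < m := by exact_mod_cast (by omega : 0 < m)
    refine ⟨by omega, ?_⟩
    have h3 := rpow_neg_tangent_le hl hm0 hn0
    have h4 : (m : ℝ) ^ (-l) ≤ (n : ℝ) ^ (-l) := h.point_anti n m hn h1
    rw [Metric.mem_ball, Real.dist_eq, abs_lt]
    constructor
    · have h5 : l * (n : ℝ) ^ (-l - 1) * (m - n) ≤ l * (n : ℝ) ^ (-l - 1) * d := by
        gcongr; linarith
      have h6 : l * (n : ℝ) ^ (-l - 1) * d = l * c * r := by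
        rw [hd]; linear_combination l * c * r * hg1
      nlinarith
    · linarith
  · intro m hm
    obtain ⟨h1, h2⟩ := hmem m hm
    have hm0 : (0 : ℝ) < m := by exact_mod_cast (by omega : 0 < m)
    exact Real.rpow_le_rpow_of_nonpos hm0 (by linarith) (by linarith)

/-- Upper bound for the mass of a ball about `n ^ (-l)`, of the order of the number of points. -/
lemma exists_pointMass_ball_power_le (hl : 0 < l) (hw : 1 < w) :
    ∃ C > 0, ∀ n : ℕ, 1 ≤ n → ∀ R, 0 < R → R ≤ 1 / 2 * (n : ℝ) ^ (-l) →
      pointMass (fun n => (n : ℝ) ^ (-l)) (fun n => (n : ℝ) ^ (-w))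
          (Metric.ball ((n : ℝ) ^ (-l)) R) ≤
        C * (1 + R * (n : ℝ) ^ (l + 1)) * (n : ℝ) ^ (-w) := by
  -- Since R ≤ x_n/2, every x_m in the ball is within a factor 2 of x_n, so m^(-l-1) and n^(-l-1)
  -- differ by at most the factor 2^((l+1)/l). The tangent inequality then confines m to within k R
  -- n^(l+1) of n.
  set k : ℝ := 2 ^ ((l + 1) / l) / l with hk
  have hk0 : 0 < k := by positivity
  refine ⟨(1 + 2 * k) * 2 ^ (w / l), by positivity, fun n hn R hR hR2 => ?_⟩
  have hn0 : (0 : ℝ) < n := Nat.cast_pos.2 hn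
  have hnl : 0 < (n : ℝ) ^ (-l) := by positivity
  set g : ℝ := (n : ℝ) ^ (l + 1) with hg
  have hg0 : 0 < g := by positivity
  have hg1 : g * (n : ℝ) ^ (-l - 1) = 1 := by
    rw [hg, show -l - 1 = -(l + 1) by ring]; exact rpow_mul_rpow_neg_self hn0 _
  obtain ⟨S, hS, hcard⟩ := exists_finset_nat_mem_Icc
    (show (n : ℝ) - k * (R * g) ≤ n + k * (R * g) by
      have : 0 ≤ k * (R * g) := by positivity
      linarith)
  have hexp : ∀ {a b : ℝ} {e : ℝ}, 0 < a → 0 < b → 0 ≤ e → a ^ (-l) ≤ 2 * b ^ (-l) →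
      a ^ (-e) ≤ 2 ^ (e / l) * b ^ (-e) := by
    intro a b e ha hb he hab
    have := Real.rpow_le_rpow (by positivity) hab (show 0 ≤ e / l by positivity)
    rwa [Real.mul_rpow two_pos.le (by positivity), ← Real.rpow_mul ha.le, ← Real.rpow_mul hb.le,
      show -l * (e / l) = -e by field_simp] at this
  refine (pointMass_le_card_mul (s := S) (q := 2 ^ (w / l) * (n : ℝ) ^ (-w)) (by positivity)
    fun m hm hmR => ?_).trans ?_
  · have hm0 : (0 : ℝ) < m := Nat.cast_pos.2 hm
    rw [Metric.mem_ball, Real.dist_eq, abs_lt] at hmR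
    refine ⟨?_, hexp hm0 hn0 (by linarith) (by linarith)⟩
    have h1 := rpow_neg_tangent_le hl hm0 hn0
    have h2 := rpow_neg_tangent_le hl hn0 hm0
    have h3 : (n : ℝ) ^ (-(l + 1)) ≤ 2 ^ ((l + 1) / l) * (m : ℝ) ^ (-(l + 1)) :=
      hexp hn0 hm0 (by linarith) (by linarith)
    rw [← neg_add'] at h1 h2 hg1
    have hone : (1 : ℝ) ≤ 2 ^ ((l + 1) / l) := Real.one_le_rpow one_le_two (by positivity)
    have hne : 0 < (n : ℝ) ^ (-(l + 1)) := by positivity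
    have hlk : l * k = 2 ^ ((l + 1) / l) := by rw [hk]; field_simp
    refine hS m ?_ ?_
    · have h4 : l * (n : ℝ) ^ (-(l + 1)) * (n - m) ≤ R := by linarith
      have h5 : l * (n - m) ≤ R * g := by
        have := mul_le_mul_of_nonneg_right h4 hg0.le
        have e : l * (n : ℝ) ^ (-(l + 1)) * (n - m) * g = l * (n - m) := by
          linear_combination l * (n - m) * hg1
        linarith
      have h6 : R * g ≤ l * k * (R * g) := by
        rw [hlk]; exact le_mul_of_one_le_left (by positivity) hone
      have h7 : (n : ℝ) - m ≤ k * (R * g) := by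
        refine le_of_mul_le_mul_left ?_ hl
        linarith
      linarith
    · rcases le_total (m : ℝ) n with hmn | hmn
      · have : 0 ≤ k * (R * g) := by positivity
        linarith
      have h4 : l * (m : ℝ) ^ (-(l + 1)) * (m - n) ≤ R := by linarith
      have h5 : l * (n : ℝ) ^ (-(l + 1)) * (m - n) ≤ l * k * R := by
        rw [hlk]
        calc l * (n : ℝ) ^ (-(l + 1)) * (m - n)
            ≤ l * (2 ^ ((l + 1) / l) * (m : ℝ) ^ (-(l + 1))) * (m - n) := by
              gcongr
          _ = 2 ^ ((l + 1) / l) * (l * (m : ℝ) ^ (-(l + 1)) * (m - n)) := by ring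
          _ ≤ _ := by gcongr
      have h6 : l * (m - n) ≤ l * (k * (R * g)) := by
        have := mul_le_mul_of_nonneg_right h5 hg0.le
        have e : l * (n : ℝ) ^ (-(l + 1)) * (m - n) * g = l * (m - n) := by
          linear_combination l * (m - n) * hg1
        linarith
      linarith [le_of_mul_le_mul_left h6 hl]
  · have h1 : (S.card : ℝ) ≤ (1 + 2 * k) * (1 + R * g) := by
      have : 0 < R * g := by positivity
      nlinarith
    calc _ ≤ (1 + 2 * k) * (1 + R * g) * (2 ^ (w / l) * (n : ℝ) ^ (-w)) := by gcongr
      _ = _ := by ring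

lemma upperRegularityDim_power (hl : 0 < l) (hw : 1 < w) :
    upperRegularityDim (sequenceMeasure (fun n => (n : ℝ) ^ (-l)) (fun n => (n : ℝ) ^ (-w))) =
      max (1 : EReal) (((w - 1) / l : ℝ) : EReal) := by
  have h := isMassSequence_power hl (rpow_neg_pos_of_one_le w) (summable_rpow_neg hw)
  have hm := massComparable_power hl hw
  have ht : 0 ≤ (w - 1) / l := div_nonneg (by linarith) hl.le
  obtain ⟨c, hc, Hc⟩ := exists_le_pointMass_ball_power hl hw
  obtain ⟨C, hC, HC⟩ := exists_pointMass_ball_power_le hl hw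
  refine le_antisymm ?_ (max_le ?_ (h.le_upperRegularityDim_of_massComparable hm))
  · rw [show max (1 : EReal) (((w - 1) / l : ℝ) : EReal) =
      ((max 1 ((w - 1) / l) : ℝ) : EReal) from (EReal.coe_strictMono.monotone.map_max).symm]
    set s := max 1 ((w - 1) / l) with hs
    have hs1 : 1 ≤ s := le_max_left _ _
    have hself : ∀ {u : ℝ}, 1 ≤ u → u ≤ u ^ s := fun hu => by
      simpa using Real.rpow_le_rpow_of_exponent_le hu hs1
    refine h.upperRegularityDim_le_of_massComparable hm ht (le_max_right _ _)
      (k := 1 / 2) (D := C / c) (E := 2 ^ s / c) (by norm_num) (by positivity) (by positivity)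
      ?_ ?_
    · intro n hn r R hr hrR hR
      have hn0 : (0 : ℝ) < n := Nat.cast_pos.2 hn
      have hR0 := hr.trans hrR
      have hx := h.point_pos n hn
      have h1 := HC n hn R hR0 hR
      have h2 := Hc n hn r hr (by linarith)
      have h3 : 1 ≤ R / r := (one_le_div hr).2 hrR.le
      set g : ℝ := (n : ℝ) ^ (l + 1) with hg
      have hg0 : 0 < g := by positivity
      -- The mass profile 1 + r g grows at most linearly in r, so the exponent 1 suffices at these
      -- scales.
      have h4 : 1 + R * g ≤ R / r * (1 + r * g) := by
        have : R / r * (1 + r * g) = R / r + R * g := by field_simp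
        linarith
      calc _ ≤ _ := h1
        _ ≤ C * (R / r * (1 + r * g)) * (n : ℝ) ^ (-w) := by gcongr
        _ = C / c * (R / r) * (c * (1 + r * g) * (n : ℝ) ^ (-w)) := by field_simp
        _ ≤ _ := by
          gcongr
          exact hself h3
    · intro n hn r hr hr2
      have hn0 : (0 : ℝ) < n := Nat.cast_pos.2 hn
      have hx := h.point_pos n hn
      have h2 := Hc n hn r hr hr2
      set X := (n : ℝ) ^ (-l) with hX
      have h3 : X / r ≤ 2 ^ s * (X / r) ^ s := by
        rw [← Real.mul_rpow two_pos.le (by positivity), ← mul_div_assoc]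
        refine le_trans ?_ (hself ((one_le_div hr).2 hr2))
        gcongr; linarith
      calc X ^ ((w - 1) / l) = X / r * (r * (n : ℝ) ^ (l + 1) * (n : ℝ) ^ (-w)) := by
            rw [hX, ← Real.rpow_mul hn0.le, show (n : ℝ) ^ (-l) / r * (r * (n : ℝ) ^ (l + 1) *
              (n : ℝ) ^ (-w)) = (n : ℝ) ^ (-l) * (n : ℝ) ^ (l + 1) * (n : ℝ) ^ (-w) by
              field_simp, ← Real.rpow_add hn0, ← Real.rpow_add hn0]
            congr 1; field_simp; ring
        _ ≤ X / r * ((1 + r * (n : ℝ) ^ (l + 1)) * (n : ℝ) ^ (-w)) := by gcongr; linarith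
        _ ≤ 2 ^ s * (X / r) ^ s * ((1 + r * (n : ℝ) ^ (l + 1)) * (n : ℝ) ^ (-w)) := by gcongr
        _ = 2 ^ s / c * (X / r) ^ s * (c * (1 + r * (n : ℝ) ^ (l + 1)) * (n : ℝ) ^ (-w)) := by
            field_simp
        _ ≤ _ := by gcongr
  · refine h.le_upperRegularityDim fun s D hs hD hH => ?_
    have h1 : 1 - s ≤ 0 := by
      refine exponent_nonpos_of_le_mul_rpow (u := fun n : ℕ => (n : ℝ)⁻¹) (l := atTop)
        (c := c) (K := D * 2 ^ s * (C * (3 / 2)))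
        (tendsto_inv_atTop_zero.comp tendsto_natCast_atTop_atTop) hc ?_
      filter_upwards [eventually_ge_atTop 1] with n hn
      have hn0 : (0 : ℝ) < n := Nat.cast_pos.2 hn
      have hn1 : (1 : ℝ) ≤ n := by exact_mod_cast hn
      have hx := h.point_pos n hn
      have e1 : (n : ℝ) ^ (-l) * (n : ℝ) ^ (l + 1) = n := by
        rw [← Real.rpow_add hn0, show -l + (l + 1) = 1 by ring, Real.rpow_one]
      -- This radius is of the order of the spacing near x_n, where the mass is O(n^(-w)), while the
      -- ball of radius x_n has mass at least of order n · n^(-w). The radii have ratio 2n, so n is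
      -- bounded by a multiple of n^s.
      set r := 1 / 2 * ((n : ℝ) ^ (-l) / n) with hr
      have hr0 : 0 < r := by positivity
      have hr2 : r ≤ 1 / 2 * (n : ℝ) ^ (-l) := by
        rw [hr]; gcongr; exact div_le_self hx.le hn1
      have h2 := hH r ((n : ℝ) ^ (-l)) hr0 (by linarith) _ (h.point_mem_support hn)
      have h3 := Hc n hn _ hx (by linarith)
      have h4 := HC n hn r hr0 hr2
      have e2 : r * (n : ℝ) ^ (l + 1) = 1 / 2 := by
        rw [hr, show 1 / 2 * ((n : ℝ) ^ (-l) / n) * (n : ℝ) ^ (l + 1) =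
          1 / 2 * ((n : ℝ) ^ (-l) * (n : ℝ) ^ (l + 1)) / n by ring, e1]
        field_simp
      have e3 : (n : ℝ) ^ (-l) / r = 2 * n := by rw [hr]; field_simp
      rw [e1] at h3
      rw [e2] at h4
      rw [e3, Real.mul_rpow two_pos.le hn0.le] at h2
      have hnw : 0 < (n : ℝ) ^ (-w) := by positivity
      have h5 : c * n * (n : ℝ) ^ (-w) ≤
          D * (2 ^ s * (n : ℝ) ^ s) * (C * (3 / 2)) * (n : ℝ) ^ (-w) := by
        calc c * n * (n : ℝ) ^ (-w) ≤ c * (1 + n) * (n : ℝ) ^ (-w) := by gcongr; linarith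
          _ ≤ _ := h3
          _ ≤ _ := h2
          _ ≤ D * (2 ^ s * (n : ℝ) ^ s) * (C * (1 + 1 / 2) * (n : ℝ) ^ (-w)) := by gcongr
          _ = _ := by ring
      have h6 := le_of_mul_le_mul_right h5 hnw
      rw [Real.inv_rpow hn0.le, Real.rpow_sub hn0, Real.rpow_one, inv_div, ← mul_div_assoc,
        le_div_iff₀ hn0]
      linarith
    exact_mod_cast sub_nonpos.1 h1

/-- The points of index n to 2n lie in B(x_n, x_n) and are 2r-separated for r of order x_n/n.
Covering them at scale r takes n + 1 balls while R/r is of order n, forcing s ≥ 1. -/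
lemma assouadDim_support_power (hl : 0 < l) (hp : ∀ n, 1 ≤ n → 0 < p n) (hps : Summable p) :
    assouadDim (sequenceMeasure (fun n => (n : ℝ) ^ (-l)) p).support = 1 := by
  have h := isMassSequence_power hl hp hps
  refine le_antisymm (assouadDim_real_le_one _) (le_sInf ?_)
  rintro _ ⟨s, ⟨hs, C, hC, H⟩, rfl⟩
  -- The gaps among these points are at least l (2n)^(-l-1) ≥ 3r, by the first entry; the second
  -- ensures r < R = x_n.
  set k : ℝ := min (l * 2 ^ (-l - 1) / 3) (1 / 2) with hk
  have hk0 : 0 < k := lt_min (by positivity) (by norm_num)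
  have hk1 : k ≤ 1 / 2 := min_le_right _ _
  have hk2 : k ≤ l * 2 ^ (-l - 1) / 3 := min_le_left _ _
  have h1 : 1 - s ≤ 0 := by
    refine exponent_nonpos_of_le_mul_rpow (u := fun n : ℕ => (n : ℝ)⁻¹) (l := atTop)
      (c := 1) (K := C / k ^ s)
      (tendsto_inv_atTop_zero.comp tendsto_natCast_atTop_atTop) one_pos ?_
    filter_upwards [eventually_ge_atTop 1] with n hn
    have hn0 : (0 : ℝ) < n := Nat.cast_pos.2 hn
    have hn1 : (1 : ℝ) ≤ n := by exact_mod_cast hn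
    have hx : 0 < (n : ℝ) ^ (-l) := by positivity
    set r : ℝ≥0 := ⟨k * (n : ℝ) ^ (-l - 1), by positivity⟩ with hr
    have hrc : (r : ℝ) = k * (n : ℝ) ^ (-l - 1) := rfl
    have hrx : (r : ℝ) = k * (n : ℝ) ^ (-l) / n := by
      rw [hrc, Real.rpow_sub_one hn0.ne']; ring
    have hr0 : (0 : ℝ) < r := by rw [hrc]; positivity
    have hrR : (r : ℝ) < (n : ℝ) ^ (-l) := by
      rw [hrx, div_lt_iff₀ hn0]; nlinarith
    have hgap : ∀ m m' : ℕ, n ≤ m → m < m' → m' ≤ 2 * n →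
        2 * (r : ℝ) < (m : ℝ) ^ (-l) - (m' : ℝ) ^ (-l) := by
      intro m m' hnm hmm hm2
      have hm0 : (0 : ℝ) < m := by exact_mod_cast (by omega : 0 < m)
      have hm0' : (0 : ℝ) < m' := by exact_mod_cast (by omega : 0 < m')
      have h2 := rpow_neg_tangent_le hl hm0 hm0'
      have h3 : (1 : ℝ) ≤ m' - m := by
        have : (m : ℝ) + 1 ≤ m' := by exact_mod_cast hmm
        linarith
      have h4 : (2 * (n : ℝ)) ^ (-l - 1) ≤ (m' : ℝ) ^ (-l - 1) :=
        Real.rpow_le_rpow_of_nonpos hm0' (by exact_mod_cast hm2) (by linarith)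
      have h5 : 3 * (r : ℝ) ≤ l * (2 * (n : ℝ)) ^ (-l - 1) := by
        rw [hrc, Real.mul_rpow two_pos.le hn0.le]
        have : 0 < (n : ℝ) ^ (-l - 1) := by positivity
        nlinarith
      have h6 : l * (2 * (n : ℝ)) ^ (-l - 1) ≤ l * (m' : ℝ) ^ (-l - 1) * (m' - m) := by
        calc l * (2 * (n : ℝ)) ^ (-l - 1) ≤ l * (m' : ℝ) ^ (-l - 1) := by gcongr
          _ ≤ _ := le_mul_of_one_le_right (by positivity) h3
      linarith
    have hgap' : ∀ m m' : ℕ, m ∈ Finset.Icc n (2 * n) → m' ∈ Finset.Icc n (2 * n) → m ≠ m' →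
        2 * (r : ℝ) < dist ((m : ℝ) ^ (-l)) ((m' : ℝ) ^ (-l)) := by
      intro m m' hm hm' hne
      rw [Finset.mem_Icc] at hm hm'
      rw [Real.dist_eq]
      rcases lt_or_gt_of_ne hne with hlt | hlt
      · exact (hgap m m' hm.1 hlt hm'.2).trans_le (le_abs_self _)
      · rw [abs_sub_comm]
        exact (hgap m' m hm'.1 hlt hm.2).trans_le (le_abs_self _)
    set P : Finset ℝ := (Finset.Icc n (2 * n)).image fun m : ℕ => (m : ℝ) ^ (-l) with hP
    have hPcard : P.card = n + 1 := by
      rw [hP, Finset.card_image_of_injOn, Nat.card_Icc]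
      · omega
      · intro m hm m' hm' heq
        by_contra hne
        have := hgap' m m' hm hm' hne
        simp only at heq
        rw [heq, dist_self] at this
        linarith
    have hPsub : (P : Set ℝ) ⊆ (sequenceMeasure (fun n => (n : ℝ) ^ (-l)) p).support ∩
        Metric.ball ((n : ℝ) ^ (-l)) ((n : ℝ) ^ (-l)) := by
      intro z hz
      obtain ⟨m, hm, rfl⟩ := Finset.mem_image.1 (Finset.mem_coe.1 hz)
      rw [Finset.mem_Icc] at hm
      refine ⟨h.point_mem_support (by omega), ?_⟩
      have h2 : (m : ℝ) ^ (-l) ≤ (n : ℝ) ^ (-l) := h.point_anti n m hn hm.1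
      have h3 : 0 < (m : ℝ) ^ (-l) := h.point_pos m (by omega)
      rw [Metric.mem_ball, Real.dist_eq, abs_lt]
      constructor <;> linarith
    have hPsep : Metric.IsSeparated ((2 * r : ℝ≥0) : ℝ≥0∞) (P : Set ℝ) := by
      intro z hz z' hz' hne
      obtain ⟨m, hm, rfl⟩ := Finset.mem_image.1 (Finset.mem_coe.1 hz)
      obtain ⟨m', hm', rfl⟩ := Finset.mem_image.1 (Finset.mem_coe.1 hz')
      have := hgap' m m' hm hm' (by rintro rfl; exact hne rfl)
      rw [edist_nndist]
      refine ENNReal.coe_lt_coe.2 ?_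
      rw [← NNReal.coe_lt_coe, coe_nndist]
      push_cast
      exact this
    have hpack := (hPsep.encard_le_packingNumber hPsub).trans
      (Metric.packingNumber_two_mul_le_externalCoveringNumber r _)
    rw [Set.encard_coe_eq_coe_finsetCard, hPcard] at hpack
    have hcov := H r ((n : ℝ) ^ (-l)) hr0 hrR _ (h.point_mem_support hn)
    have hle : ((n + 1 : ℕ) : ℝ≥0∞) ≤ ENNReal.ofReal (C * ((n : ℝ) ^ (-l) / r) ^ s) := by
      refine le_trans ?_ hcov
      exact_mod_cast hpack
    rw [ENNReal.natCast_le_ofReal (by omega)] at hle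
    have e3 : (n : ℝ) ^ (-l) / r = n / k := by rw [hrx]; field_simp
    rw [e3, Real.div_rpow hn0.le hk0.le] at hle
    push_cast at hle
    rw [Real.inv_rpow hn0.le, Real.rpow_sub hn0, Real.rpow_one, inv_div, ← mul_div_assoc,
      le_div_iff₀ hn0]
    have e4 : C / k ^ s * (n : ℝ) ^ s = C * ((n : ℝ) ^ s / k ^ s) := by ring
    linarith
  exact EReal.coe_le_coe (sub_nonpos.1 h1)

end Power

/-! ### Mixed rates: failure of doubling. -/

section MixedRates

variable {l w : ℝ}

/-- At the origin with r = (2j)^(-l), the mass is O(w^(2j)), while a fixed dilation reaches j^(-l) =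
2^l r and so captures at least w^j. The added 1 in the factor 2^l + 1 puts this point strictly
inside the open ball. -/
lemma not_isDoublingMeas_power_geometric (hl : 0 < l) (hw0 : 0 < w) (hw1 : w < 1) :
    ¬ IsDoublingMeas (sequenceMeasure (fun n => (n : ℝ) ^ (-l)) (fun n => w ^ n)) ∧
      upperRegularityDim (sequenceMeasure (fun n => (n : ℝ) ^ (-l)) (fun n => w ^ n)) = ⊤ := by
  have h := isMassSequence_power (p := fun n => w ^ n) hl (fun n _ => pow_pos hw0 n)
    (summable_geometric_of_lt_one hw0.le hw1)
  have h2l : (0 : ℝ) < 2 ^ l := by positivity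
  refine h.not_isDoublingMeas_and_upperRegularityDim_eq_top (k := 2 ^ l + 1) (by linarith)
    fun C => ?_
  have hlim : Tendsto (fun j : ℕ => |C| / (1 - w) * w ^ j) atTop (𝓝 (|C| / (1 - w) * 0)) :=
    (tendsto_pow_atTop_nhds_zero_of_lt_one hw0.le hw1).const_mul _
  rw [mul_zero] at hlim
  obtain ⟨j, hj, hj1⟩ := ((hlim.eventually_lt_const one_pos).and (eventually_ge_atTop 1)).exists
  have hj0 : (0 : ℝ) < j := Nat.cast_pos.2 hj1
  have hr : 0 < ((2 * j : ℕ) : ℝ) ^ (-l) := by positivity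
  refine ⟨0, h.zero_mem_support, ((2 * j : ℕ) : ℝ) ^ (-l), hr, ?_⟩
  have h1 := h.pointMass_le_tail (A := Metric.ball 0 (((2 * j : ℕ) : ℝ) ^ (-l))) (N := 2 * j)
    (by omega) fun m hm hmr => by
      by_contra! hmj
      have := h.point_anti m (2 * j) hm hmj.le
      rw [Metric.mem_ball, Real.dist_eq, sub_zero] at hmr
      linarith [le_abs_self ((m : ℝ) ^ (-l))]
  rw [tsum_geometric_tail hw0 hw1] at h1
  have h2 : w ^ j ≤ pointMass (fun n => (n : ℝ) ^ (-l)) (fun n => w ^ n)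
      (Metric.ball 0 ((2 ^ l + 1) * ((2 * j : ℕ) : ℝ) ^ (-l))) := by
    refine h.weight_le_pointMass hj1 ?_
    have e : (j : ℝ) ^ (-l) = 2 ^ l * ((2 * j : ℕ) : ℝ) ^ (-l) := by
      push_cast
      rw [Real.mul_rpow two_pos.le hj0.le, ← mul_assoc, rpow_mul_rpow_neg_self two_pos, one_mul]
    rw [Metric.mem_ball, Real.dist_eq, sub_zero, abs_of_pos (by positivity), e]
    linarith
  have hwj := pow_pos hw0 j
  calc C * pointMass (fun n => (n : ℝ) ^ (-l)) (fun n => w ^ n)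
        (Metric.ball 0 (((2 * j : ℕ) : ℝ) ^ (-l)))
      ≤ |C| * (w ^ (2 * j) / (1 - w)) :=
        mul_le_mul (le_abs_self C) h1 (h.pointMass_nonneg _) (abs_nonneg C)
    _ = |C| / (1 - w) * w ^ j * w ^ j := by rw [two_mul, pow_add]; ring
    _ < 1 * w ^ j := by gcongr
    _ ≤ _ := by rwa [one_mul]

/-- The ball about l^n of radius (1 - l) l^n has only the mass n^(-w) of its centre, while radius 2
l^n captures the whole tail, of mass at least n^(1-w)/(w-1). The ratio is at least n/(w-1), which is
unbounded. -/
lemma not_isDoublingMeas_geometric_power (hl0 : 0 < l) (hl1 : l < 1) (hw : 1 < w) :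
    ¬ IsDoublingMeas (sequenceMeasure (fun n => l ^ n) (fun n => (n : ℝ) ^ (-w))) ∧
      upperRegularityDim (sequenceMeasure (fun n => l ^ n) (fun n => (n : ℝ) ^ (-w))) = ⊤ := by
  have h := isMassSequence_geometric hl0 hl1 (rpow_neg_pos_of_one_le w) (summable_rpow_neg hw)
  have h1l : 0 < 1 - l := by linarith
  have ha : 0 < w - 1 := by linarith
  refine h.not_isDoublingMeas_and_upperRegularityDim_eq_top (k := 2 / (1 - l))
    ((one_lt_div h1l).2 (by linarith)) fun C => ?_
  obtain ⟨n, hnC⟩ := exists_nat_gt (max (|C| * (w - 1)) 1)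
  have hn0 : (0 : ℝ) < n := by linarith [le_max_right (|C| * (w - 1)) 1]
  have hn : 1 ≤ n := Nat.cast_pos.1 hn0
  have hx := pow_pos hl0 n
  refine ⟨l ^ n, h.point_mem_support hn, (1 - l) * l ^ n, by positivity, ?_⟩
  have h1 : pointMass (fun n => l ^ n) (fun n => (n : ℝ) ^ (-w))
      (Metric.ball (l ^ n) ((1 - l) * l ^ n)) ≤ (({n} : Finset ℕ).card : ℝ) * (n : ℝ) ^ (-w) := by
    refine pointMass_le_card_mul (by positivity) fun m _ hmR => ?_
    have := geometric_mem_ball_iff hl0 hl1 le_rfl hmR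
    subst this
    exact ⟨Finset.mem_singleton_self _, le_rfl⟩
  rw [Finset.card_singleton, Nat.cast_one, one_mul] at h1
  rw [show 2 / (1 - l) * ((1 - l) * l ^ n) = 2 * l ^ n by field_simp]
  have h2 := (le_tsum_rpow_neg_tail hw hn).trans
    (h.tail_le_pointMass (A := Metric.ball (l ^ n) (2 * l ^ n)) hn fun m hm => by
      have h3 := pow_le_pow_of_le_one hl0.le hl1.le hm
      have h4 := pow_pos hl0 m
      rw [Metric.mem_ball, Real.dist_eq, abs_lt]
      constructor <;> linarith)
  refine lt_of_lt_of_le ?_ h2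
  have hnw : 0 < (n : ℝ) ^ (-w) := by positivity
  have hnC' : |C| * (w - 1) < n := (le_max_left _ _).trans_lt hnC
  calc C * pointMass (fun n => l ^ n) (fun n => (n : ℝ) ^ (-w))
        (Metric.ball (l ^ n) ((1 - l) * l ^ n))
      ≤ |C| * (n : ℝ) ^ (-w) :=
        mul_le_mul (le_abs_self C) h1 (h.pointMass_nonneg _) (abs_nonneg C)
    _ < (n : ℝ) ^ (1 - w) / (w - 1) := by
        rw [lt_div_iff₀ ha, sub_eq_add_neg 1 w, Real.rpow_add hn0, Real.rpow_one]
        nlinarith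

end MixedRates

theorem theorem2p6 :
    -- polynomial-polynomial
    (∀ lam ω : ℝ, 0 < lam → 1 < ω → ∀ μ : Measure ℝ,
      μ = sequenceMeasure (fun n => (n : ℝ) ^ (-lam)) (fun n => (n : ℝ) ^ (-ω)) →
        upperRegularityDim μ = max (1 : EReal) (((ω - 1) / lam : ℝ) : EReal) ∧
        max (1 : EReal) (((ω - 1) / lam : ℝ) : EReal) =
          max (assouadDim μ.support) (⨆ x ∈ μ.support, upperLocalDim μ x)) ∧
    -- exponential-exponential
    (∀ lam ω : ℝ, 0 < lam → lam < 1 → 0 < ω → ω < 1 → ∀ μ : Measure ℝ,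
      μ = sequenceMeasure (fun n => lam ^ n) (fun n => ω ^ n) →
        upperRegularityDim μ = ((Real.log ω / Real.log lam : ℝ) : EReal) ∧
        ((Real.log ω / Real.log lam : ℝ) : EReal) = (⨆ x ∈ μ.support, upperLocalDim μ x) ∧
        (0 : EReal) < (⨆ x ∈ μ.support, upperLocalDim μ x) ∧
        assouadDim μ.support = 0) ∧
    -- polynomially converging points, exponentially decaying masses
    (∀ lam ω : ℝ, 0 < lam → 0 < ω → ω < 1 → ∀ μ : Measure ℝ,
      μ = sequenceMeasure (fun n => (n : ℝ) ^ (-lam)) (fun n => ω ^ n) →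
        ¬ IsDoublingMeas μ ∧ upperRegularityDim μ = ⊤) ∧
    -- exponentially converging points, polynomially decaying masses
    (∀ lam ω : ℝ, 0 < lam → lam < 1 → 1 < ω → ∀ μ : Measure ℝ,
      μ = sequenceMeasure (fun n => lam ^ n) (fun n => (n : ℝ) ^ (-ω)) →
        ¬ IsDoublingMeas μ ∧ upperRegularityDim μ = ⊤) := by
  refine ⟨?_, ?_, ?_, ?_⟩
  · rintro l w hl hw _ rfl
    have h := isMassSequence_power hl (rpow_neg_pos_of_one_le w) (summable_rpow_neg hw)
    refine ⟨upperRegularityDim_power hl hw, ?_⟩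
    rw [assouadDim_support_power hl (rpow_neg_pos_of_one_le w) (summable_rpow_neg hw),
      h.iSup_upperLocalDim_eq (massComparable_power hl hw) (div_nonneg (by linarith) hl.le)]
  · rintro l w hl0 hl1 hw0 hw1 _ rfl
    have hw := summable_geometric_of_lt_one hw0.le hw1
    have h := isMassSequence_geometric hl0 hl1 (fun n _ => pow_pos hw0 n) hw
    have ht : 0 < Real.log w / Real.log l :=
      div_pos_of_neg_of_neg (Real.log_neg hw0 hw1) (Real.log_neg hl0 hl1)
    rw [h.iSup_upperLocalDim_eq (massComparable_geometric hl0 hl1 hw0 hw1) ht.le]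
    exact ⟨upperRegularityDim_geometric hl0 hl1 hw0 hw1, rfl, EReal.coe_pos.2 ht,
      assouadDim_support_geometric hl0 hl1 (fun n _ => pow_pos hw0 n) hw⟩
  · rintro l w hl hw0 hw1 _ rfl
    exact not_isDoublingMeas_power_geometric hl hw0 hw1
  · rintro l w hl0 hl1 hw _ rfl
    exact not_isDoublingMeas_geometric_power hl0 hl1 hw
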